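/- Let $F$ be a free group of finite rank $n>1$ with a fixed free basis, let $T$ be the Cayley tree of $F$ with respect to this basis, with boundary at infinity $\partial T$, and let $\underline{w}=\{w_1,\dots,w_k\}\subset F$ be a multiword, that is, a finite collection of nontrivial elements of $F$. For $g,h\in F$ with $h\neq 1$, write $gh^{\infty}\in\partial T$ for the limit of the sequence of vertices $(gh^i)_{i\ge 0}$, and $gh^{-\infty}=g(h^{-1})^{\infty}$. The decomposition space $\mathcal{D}=\mathcal{D}_{\underline{w}}$ is the quotient of $\partial T$ obtained by identifying the two points $gw^{\infty}$ and $gw^{-\infty}$ for every $w\in\underline{w}$ and every $g\in F$; the group $F$ acts on $\mathcal{D}$ by homeomorphisms. A cut set in $\mathcal{D}$ is a subset whose complement is not connected; a cut point is a point $x$ such that $\{x\}$ is a cut set; a cut pair is a two point cut set neither of whose points is a cut point. A cut pair $\{x_0,x_1\}$ crosses a cut pair $\{y_0,y_1\}$ if $x_0$ and $x_1$ lie in different connected components of $\mathcal{D}\setminus\{y_0,y_1\}$. A cut pair is uncrossed if no cut pair crosses it. Proposition. Suppose that $\mathcal{D}$ is connected (equivalently, $F$ does not split freely relative to $\underline{w}$).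 Then there are only finitely many $F$-orbits of cut points of $\mathcal{D}$, and only finitely many $F$-orbits of uncrossed cut pairs of $\mathcal{D}$. -/

import Mathlib

open Filter
open scoped Pointwise

/-- The inverse of a letter: `(a, true)` stands for the basis element `a`, `(a, false)` for its
inverse. -/
def letterInv {α : Type*} (s : α × Bool) : α × Bool := (s.1, !s.2)

theorem letterInv_letterInv {α : Type*} (s : α × Bool) : letterInv (letterInv s) = s := by
  simp [letterInv]

theorem letterInv_ne {α : Type*} (s : α × Bool) : letterInv s ≠ s := by
  intro h
  have := congrArg Prod.snd h
  simp [letterInv] at this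

/-- The boundary at infinity of the Cayley tree of the free group `FreeGroup α` with respect to
its basis `α`. A point is the geodesic ray from the identity vertex that represents it, i.e. an
infinite reduced word. -/
def FreeBoundary (α : Type*) : Type _ :=
  {ξ : ℕ → α × Bool // ∀ n, ξ (n + 1) ≠ letterInv (ξ n)}

namespace FreeBoundary

/-- Two points are close when their rays from the identity have a long common initial segment:
the topology is that of a subspace of the product of copies of the discrete set of letters. -/
instance (α : Type*) : TopologicalSpace (FreeBoundary α) :=
  TopologicalSpace.induced (fun ξ : FreeBoundary α => ξ.1)
    (@Pi.topologicalSpace ℕ (fun _ => α × Bool) (fun _ => ⊥))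

section
variable {α : Type*}

/-- Remove the first letter. -/
def tail (ξ : FreeBoundary α) : FreeBoundary α :=
  ⟨fun n => ξ.1 (n + 1), fun n => ξ.2 (n + 1)⟩

/-- Put a letter in front of an infinite reduced word that does not start with its inverse. -/
def cons (s : α × Bool) (ξ : FreeBoundary α) (h : ξ.1 0 ≠ letterInv s) : FreeBoundary α :=
  ⟨fun n => Nat.casesOn n s ξ.1, fun n => by
    cases n with
    | zero => exact h
    | succ n => exact ξ.2 n⟩

variable [DecidableEq α]

/-- Left multiplication of an infinite reduced word by a letter, followed by reduction. -/
def letterMul (s : α × Bool) (ξ : FreeBoundary α) : FreeBoundary α :=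
  if h : ξ.1 0 = letterInv s then ξ.tail else cons s ξ h

theorem letterMul_letterInv (s : α × Bool) (ξ : FreeBoundary α) :
    letterMul (letterInv s) (letterMul s ξ) = ξ := by
  by_cases h : ξ.1 0 = letterInv s
  · have h1 : ξ.tail.1 0 ≠ letterInv (letterInv s) := by
      rw [← h]; exact ξ.2 0
    have h2 : letterMul s ξ = ξ.tail := dif_pos h
    rw [h2, letterMul, dif_neg h1]
    apply Subtype.ext
    funext n
    cases n with
    | zero => exact h.symm
    | succ n => rfl
  · have h2 : letterMul s ξ = cons s ξ h := dif_neg h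
    have h1 : (cons s ξ h).1 0 = letterInv (letterInv s) := (letterInv_letterInv s).symm
    rw [h2, letterMul, dif_pos h1]
    rfl

/-- Left multiplication by a basis element, as a permutation of the boundary. -/
def genPerm (a : α) : Equiv.Perm (FreeBoundary α) where
  toFun := letterMul (a, true)
  invFun := letterMul (a, false)
  left_inv := letterMul_letterInv (a, true)
  right_inv := letterMul_letterInv (a, false)

/-- The action of the free group on the boundary that extends left multiplication on the tree. -/
instance : MulAction (FreeGroup α) (FreeBoundary α) :=
  MulAction.compHom (FreeBoundary α) (FreeGroup.lift (genPerm (α := α)))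

/-- The sequence of vertices `u` of the tree converges to the boundary point `ξ`: for every `n`,
the geodesics from the identity to `u i` eventually share their first `n` edges with the ray of
`ξ`. -/
def VertexLimit (u : ℕ → FreeGroup α) (ξ : FreeBoundary α) : Prop :=
  ∀ n : ℕ, ∀ᶠ i in atTop, (u i).toWord.take n = (List.range n).map ξ.1

/-- `IsAxisEnd g h ξ` says that `ξ = g h^∞`, the limit of the vertices `g h ^ i`. -/
def IsAxisEnd (g h : FreeGroup α) (ξ : FreeBoundary α) : Prop :=
  VertexLimit (fun i => g * h ^ i) ξ

theorem VertexLimit.letterMul {u : ℕ → FreeGroup α} {ξ : FreeBoundary α}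
    (h : VertexLimit u ξ) (s : α × Bool) :
    VertexLimit (fun i => FreeGroup.mk [s] * u i) (letterMul s ξ) := by
  have key : ∀ i, (FreeGroup.mk [s] * u i).toWord =
      FreeGroup.reduce (s :: (u i).toWord) := by
    intro i
    conv_lhs => rw [← FreeGroup.mk_toWord (x := u i)]
    rw [FreeGroup.mul_mk, FreeGroup.toWord_mk]; rfl
  have red : ∀ i, FreeGroup.reduce (u i).toWord = (u i).toWord := fun i =>
    FreeGroup.reduce_toWord (u i)
  intro n
  filter_upwards [h (n + 1), h 1, h (n - 1)] with i hi h1 h0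
  rw [key, FreeGroup.reduce.cons, red]
  cases hw : (u i).toWord with
  | nil => simp [hw] at h1
  | cons t l =>
    simp only [hw, List.take_succ_cons, List.take_zero, List.range_succ_eq_map, List.map_cons,
      List.range_zero, List.map_nil, List.cons.injEq, and_true, List.map_map] at h1 hi
    obtain ⟨ht, hl⟩ := hi
    have e : (s.1 = t.1 ∧ s.2 = !t.2) ↔ ξ.1 0 = letterInv s := by
      rw [← ht]
      obtain ⟨a, b⟩ := s
      obtain ⟨c, d⟩ := t
      simp only [letterInv, Prod.mk.injEq]
      constructor
      · rintro ⟨rfl, rfl⟩; simp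
      · rintro ⟨rfl, rfl⟩; simp
    by_cases hc : ξ.1 0 = letterInv s
    · have h2 : FreeBoundary.letterMul s ξ = ξ.tail := dif_pos hc
      simp only [h2, if_pos (e.2 hc), hl]
      rfl
    · have h2 : FreeBoundary.letterMul s ξ = cons s ξ hc := dif_neg hc
      simp only [h2, if_neg (fun hh => hc (e.1 hh))]
      cases n with
      | zero => simp
      | succ m =>
        have hm : (t :: l).take m = (List.range m).map ξ.1 := by
          rw [← hw]; simpa using h0
        rw [List.take_succ_cons, hm, List.range_succ_eq_map, List.map_cons, List.map_map]
        rfl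

/-- The action on the boundary is compatible with left multiplication on the vertices. -/
theorem VertexLimit.smul {u : ℕ → FreeGroup α} {ξ : FreeBoundary α}
    (h : VertexLimit u ξ) (g : FreeGroup α) :
    VertexLimit (fun i => g * u i) (g • ξ) := by
  have hof : ∀ a : α, ∀ η : FreeBoundary α,
      FreeGroup.of a • η = FreeBoundary.letterMul (a, true) η := by
    intro a η
    change FreeGroup.lift (genPerm (α := α)) (FreeGroup.of a) η = _
    rw [FreeGroup.lift_apply_of]
    rfl
  have hinv : ∀ a : α, ∀ η : FreeBoundary α,
      (FreeGroup.of a)⁻¹ • η = FreeBoundary.letterMul (a, false) η := by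
    intro a η
    change FreeGroup.lift (genPerm (α := α)) (FreeGroup.of a)⁻¹ η = _
    rw [map_inv, FreeGroup.lift_apply_of]
    rfl
  induction g using FreeGroup.induction_on generalizing u ξ with
  | C1 => simpa using h
  | of a => rw [hof]; exact h.letterMul (a, true)
  | inv_of a _ => rw [hinv]; exact h.letterMul (a, false)
  | mul x y hx hy => simpa only [mul_smul, mul_assoc] using hx (hy h)

end

end FreeBoundary

section
variable {α : Type*} [DecidableEq α]

/-- `ξ` and `η` are the endpoints `g w^∞` and `g w^{-∞}` of a line of the line pattern generated
by the multiword `W`: the `w`-line through a vertex `g`, for some word `w` of `W`. -/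
def LineEnds (W : Finset (FreeGroup α)) (ξ η : FreeBoundary α) : Prop :=
  ∃ w ∈ W, ∃ g : FreeGroup α,
    FreeBoundary.IsAxisEnd g w ξ ∧ FreeBoundary.IsAxisEnd g w⁻¹ η

theorem LineEnds.smul {W : Finset (FreeGroup α)} (g : FreeGroup α) {ξ η : FreeBoundary α}
    (h : LineEnds W ξ η) : LineEnds W (g • ξ) (g • η) := by
  obtain ⟨w, hw, k, h1, h2⟩ := h
  refine ⟨w, hw, g * k, ?_, ?_⟩
  · simpa only [FreeBoundary.IsAxisEnd, mul_assoc] using h1.smul g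
  · simpa only [FreeBoundary.IsAxisEnd, mul_assoc] using h2.smul g

/-- The decomposition space of a multiword: the quotient of the boundary of the tree by the
equivalence relation that identifies the two endpoints of each line of the line pattern. -/
def DecompositionSpace (W : Finset (FreeGroup α)) : Type _ := Quot (LineEnds W)

instance (W : Finset (FreeGroup α)) : TopologicalSpace (DecompositionSpace W) :=
  inferInstanceAs (TopologicalSpace (Quot (LineEnds W)))

/-- The action on the decomposition space that is induced by the action on the boundary. -/
instance (W : Finset (FreeGroup α)) : MulAction (FreeGroup α) (DecompositionSpace W) where
  smul g := Quot.map (fun ξ => g • ξ) (fun _ _ h => h.smul g)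
  one_smul x := by
    induction x using Quot.ind with
    | mk ξ => exact congrArg (Quot.mk _) (one_smul _ ξ)
  mul_smul g h x := by
    induction x using Quot.ind with
    | mk ξ => exact congrArg (Quot.mk _) (mul_smul g h ξ)

end

section
variable {X : Type*} [TopologicalSpace X]

/-- A cut set is a set whose complement is not connected. -/
def IsCutSet (S : Set X) : Prop := ¬ IsPreconnected Sᶜ

/-- A cut point is a point that is a cut set. -/
def IsCutPoint (x : X) : Prop := IsCutSet ({x} : Set X)

/-- A cut pair is a two point cut set, neither point of which is a cut point. -/
def IsCutPair (S : Set X) : Prop :=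
  IsCutSet S ∧ ∃ x y : X, x ≠ y ∧ S = {x, y} ∧ ¬ IsCutPoint x ∧ ¬ IsCutPoint y

/-- The pair `S` crosses `T`: the points of `S` lie in different connected components of the
complement of `T`. -/
def Crosses (S T : Set X) : Prop :=
  ∃ x y : X, S = {x, y} ∧ x ∈ Tᶜ ∧ y ∈ Tᶜ ∧ y ∉ connectedComponentIn Tᶜ x

/-- An uncrossed cut pair is a cut pair that is not crossed by any cut pair. -/
def IsUncrossedCutPair (S : Set X) : Prop :=
  IsCutPair S ∧ ∀ T : Set X, IsCutPair T → ¬ Crosses T S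

end

/-! Cut points. Suppose a point with a single representing ray `ξ` had a complement split into `A`
and `B`. Seen from a vertex far along `ξ`, the rays of `A` in the branch behind form a clopen set
compatible with the lines inside that branch. Connectedness leaves only finitely many such sets,
since each is determined by which ends of the finitely many lines through the base vertex it
contains (`finite_compatibleClopens`). So a single depth `d` decides membership in all of them. A
ray of `A` and a ray of `B` agree on `d` letters when seen from far enough, which is absurd
(`not_isCutPoint_of_fiber`). Hence every cut point is a line, and each word contributes at most one
orbit of lines.

Uncrossed cut pairs. Two distinct points are separated by an edge of the tree or are lines through a
common vertex (`exists_separating_edge_or_vertex`). Up to translation the vertex is the identity,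
where only finitely many lines pass. In the other case the edge may be taken at the identity, and
the lines crossing it form a finite wall `E` between two sides `L` and `M`. A partition for a cut
pair `{x, y}` with `x ∈ L`, `y ∈ M` cuts `E` into a trace `P` and the rest. Fix `P`. If `x` had
points `x'` and `x''` of other such pairs on its two sides, the equal traces would make `{x', x''}`
a cut pair crossing `{x, y}` (`IsUncrossedAcross.extremal`). So every `x` is extremal, which leaves
at most two of them, and likewise for `y`. As `E` has finitely many subsets, finitely many pairs
remain (`finite_uncrossed_across_wall`). -/

/-! ### Cut pairs separated by a wall in a topological space. -/

section CutSets
variable {X : Type*} [TopologicalSpace X]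

/-- `A` and `B` form a nontrivial relatively clopen partition of the complement of the closed
set `S`. -/
structure IsCutPartition (S A B : Set X) : Prop where
  disjoint : Disjoint A B
  union : A ∪ B = Sᶜ
  nonempty_left : A.Nonempty
  nonempty_right : B.Nonempty
  closed_left : IsClosed (A ∪ S)
  closed_right : IsClosed (B ∪ S)

theorem IsCutPartition.symm {S A B : Set X} (h : IsCutPartition S A B) :
    IsCutPartition S B A :=
  ⟨h.disjoint.symm, by rw [Set.union_comm, h.union], h.nonempty_right, h.nonempty_left,
    h.closed_right, h.closed_left⟩

theorem IsCutPartition.compl_left {S A B : Set X} (h : IsCutPartition S A B) :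
    (B ∪ S)ᶜ = A := by
  ext z
  have h1 := (Set.ext_iff.1 h.union) z
  have h2 : z ∈ A → z ∉ B := fun a => Set.disjoint_left.1 h.disjoint a
  grind

theorem IsCutPartition.isOpen_left {S A B : Set X} (h : IsCutPartition S A B) : IsOpen A := by
  rw [← h.compl_left]; exact h.closed_right.isOpen_compl

theorem IsCutPartition.isCutSet {S A B : Set X} (h : IsCutPartition S A B) : IsCutSet S := by
  intro hp
  obtain ⟨z, -, hz⟩ := hp A B h.isOpen_left h.symm.isOpen_left h.union.ge
    (by
      obtain ⟨a, ha⟩ := h.nonempty_left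
      exact ⟨a, h.union ▸ Or.inl ha, ha⟩)
    (by
      obtain ⟨b, hb⟩ := h.nonempty_right
      exact ⟨b, h.union ▸ Or.inr hb, hb⟩)
  exact Set.disjoint_left.1 h.disjoint hz.1 hz.2

theorem IsCutSet.exists_partition {S : Set X} (hS : IsClosed S) (h : IsCutSet S) :
    ∃ A B, IsCutPartition S A B := by
  simp only [IsCutSet, IsPreconnected, not_forall, exists_prop] at h
  obtain ⟨u, v, hu, hv, hsub, hnu, hnv, hne⟩ := h
  have hd : ∀ z, z ∉ S → z ∈ u → z ∈ v → False := fun z h1 h2 h3 => hne ⟨z, h1, h2, h3⟩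
  have hc : ∀ z, z ∉ S → z ∈ u ∨ z ∈ v := fun z hz => hsub hz
  refine ⟨u ∩ Sᶜ, v ∩ Sᶜ, Set.disjoint_left.2 fun z h1 h2 => hd z h1.2 h1.1 h2.1, ?_,
    by rwa [Set.inter_comm], by rwa [Set.inter_comm], ?_, ?_⟩
  · ext z
    have := hc z
    simp only [Set.mem_union, Set.mem_inter_iff, Set.mem_compl_iff]
    grind
  · have : u ∩ Sᶜ ∪ S = (v ∩ Sᶜ)ᶜ := by
      ext z
      have h1 := hc z
      have h2 := hd z
      simp only [Set.mem_union, Set.mem_inter_iff, Set.mem_compl_iff]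
      grind
    rw [this]
    exact (hv.inter hS.isOpen_compl).isClosed_compl
  · have : v ∩ Sᶜ ∪ S = (u ∩ Sᶜ)ᶜ := by
      ext z
      have h1 := hc z
      have h2 := hd z
      simp only [Set.mem_union, Set.mem_inter_iff, Set.mem_compl_iff]
      grind
    rw [this]
    exact (hu.inter hS.isOpen_compl).isClosed_compl

theorem IsCutPartition.notMem_connectedComponentIn {S A B : Set X} (h : IsCutPartition S A B)
    {p q : X} (hp : p ∈ A) (hq : q ∈ B) : q ∉ connectedComponentIn Sᶜ p := by
  intro hmem
  have hpS : p ∈ Sᶜ := h.union ▸ Or.inl hp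
  obtain ⟨z, -, hz⟩ := isPreconnected_connectedComponentIn (x := p) (F := Sᶜ) A B h.isOpen_left
    h.symm.isOpen_left ((connectedComponentIn_subset _ _).trans h.union.ge)
    ⟨p, mem_connectedComponentIn hpS, hp⟩ ⟨q, hmem, hq⟩
  exact Set.disjoint_left.1 h.disjoint hz.1 hz.2

/-- A relatively clopen subset of the complement of a point that is not a cut point is trivial. -/
theorem eq_empty_of_not_isCutPoint {x y : X} (hx : ¬ IsCutPoint x) (hxy : y ≠ x) {C : Set X}
    (hxC : x ∉ C) (hyC : y ∉ C) (h1 : IsClosed (C ∪ {x})) (h2 : IsClosed Cᶜ) : C = ∅ := by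
  by_contra hne
  refine hx (IsCutPartition.isCutSet (A := C) (B := (C ∪ {x})ᶜ) ⟨?_, ?_, ?_, ?_, h1, ?_⟩)
  · exact Set.disjoint_left.2 fun z h h' => h' (Or.inl h)
  · ext z
    by_cases hz : z ∈ C
    · simp only [Set.mem_union, hz, true_or, Set.mem_compl_iff, Set.mem_singleton_iff, true_iff]
      rintro rfl
      exact hxC hz
    · simp [hz]
  · exact Set.nonempty_iff_ne_empty.2 hne
  · exact ⟨y, by simp [hyC, hxy]⟩
  · have : (C ∪ {x})ᶜ ∪ {x} = Cᶜ := by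
      ext z
      by_cases hz : z = x
      · simp [hz, hxC]
      · simp [hz]
    rwa [this]

/-- The space is divided by the "wall" `E` into the sides `L` and `M`. -/
structure IsWall (L E M : Set X) : Prop where
  left_wall : Disjoint L E
  wall_right : Disjoint E M
  left_right : Disjoint L M
  union : L ∪ E ∪ M = Set.univ
  closed_left : IsClosed (L ∪ E)
  closed_right : IsClosed (M ∪ E)

theorem IsWall.symm {L E M : Set X} (h : IsWall L E M) : IsWall M E L :=
  ⟨h.wall_right.symm, h.left_wall.symm, h.left_right.symm, by
    rw [Set.union_comm, ← Set.union_assoc, Set.union_right_comm, h.union],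
    h.closed_right, h.closed_left⟩

/-- `A` and `B` form a relatively clopen partition of `(L ∪ E) \ {x}` that cuts the wall `E` into
`P` and the rest. -/
structure IsHalfCut (L E : Set X) (x : X) (P A B : Set X) : Prop where
  mem : x ∈ L
  disjoint : Disjoint A B
  union : A ∪ B = (L ∪ E) \ {x}
  closed_left : IsClosed (A ∪ {x})
  closed_right : IsClosed (B ∪ {x})
  trace : A ∩ E = P

namespace IsHalfCut
variable {L E M : Set X} {x x' x'' y : X} {P A B A' B' A'' B'' : Set X}

theorem symm (hw : IsWall L E M) (h : IsHalfCut L E x P A B) :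
    IsHalfCut L E x (E \ P) B A where
  mem := h.mem
  disjoint := h.disjoint.symm
  union := by rw [Set.union_comm, h.union]
  closed_left := h.closed_right
  closed_right := h.closed_left
  trace := by
    ext z
    have h1 := (Set.ext_iff.1 h.union) z
    have h2 : z ∈ A → z ∉ B := fun a => Set.disjoint_left.1 h.disjoint a
    have h3 := Set.ext_iff.1 h.trace z
    have h4 := Set.disjoint_left.1 hw.left_wall h.mem
    have h5 : z ∈ E → z ≠ x := by rintro hz rfl; exact h4 hz
    grind

/-- Pointwise description of a half cut, for propositional reasoning. -/
theorem pointwise (hw : IsWall L E M) (h : IsHalfCut L E x P A B) (z : X) :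
    (z ∈ L → z ∉ E) ∧ (z ∈ E → z ∉ M) ∧ (z ∈ L → z ∉ M) ∧ (z ∈ L ∨ z ∈ E ∨ z ∈ M) ∧
    (z = x → z ∈ L) ∧ (z ∈ A → z ∉ B) ∧ ((z ∈ A ∨ z ∈ B) ↔ ((z ∈ L ∨ z ∈ E) ∧ z ≠ x)) ∧
    (z ∈ P ↔ z ∈ A ∧ z ∈ E) := by
  refine ⟨fun a b => Set.disjoint_left.1 hw.left_wall a b,
    fun a b => Set.disjoint_left.1 hw.wall_right a b,
    fun a b => Set.disjoint_left.1 hw.left_right a b, ?_, ?_,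
    fun a b => Set.disjoint_left.1 h.disjoint a b, ?_, ?_⟩
  · have := Set.ext_iff.1 hw.union z
    simp only [Set.mem_union, Set.mem_univ, iff_true] at this
    grind
  · rintro rfl; exact h.mem
  · simpa using Set.ext_iff.1 h.union z
  · simpa using (Set.ext_iff.1 h.trace z).symm

/-- Two half cuts with the same trace on the wall are nested. -/
theorem nested (hw : IsWall L E M) (hy : y ∈ M) (h : IsHalfCut L E x P A B)
    (hx : ¬ IsCutPoint x) (h' : IsHalfCut L E x' P A' B') (hx' : x' ∈ A) : B ∩ A' = ∅ := by
  have p := h.pointwise hw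
  have p' := h'.pointwise hw
  have hxx' : x' ≠ x := ((p x').2.2.2.2.2.2.1.1 (Or.inl hx')).2
  -- `B ∩ A'` misses the wall because both traces are `P`, and `x' ∉ B`; so its only possible limit
  -- point outside itself is `x`.
  refine eq_empty_of_not_isCutPoint hx (y := y) ?_ ?_ ?_ ?_ ?_
  · rintro rfl; exact Set.disjoint_left.1 hw.left_right h.mem hy
  · intro hz
    exact ((p x).2.2.2.2.2.2.1.1 (Or.inr hz.1)).2 rfl
  · intro hz
    have := p y
    have := hz.1
    grind
  · have : B ∩ A' ∪ {x} = (B ∪ {x}) ∩ ((A' ∪ {x'}) ∪ {x}) := by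
      ext z
      have q := p z
      have q' := p' z
      have : z = x' → z ∈ A := by rintro rfl; exact hx'
      grind
    rw [this]
    exact h.closed_right.inter (h'.closed_left.union (by
      have : ({x} : Set X) = (A ∪ {x}) ∩ (B ∪ {x}) := by
        ext z
        have q := p z
        grind
      rw [this]
      exact h.closed_left.inter h.closed_right))
  · have : (B ∩ A')ᶜ = (A ∪ {x}) ∪ (B' ∪ {x'}) ∪ (M ∪ E) := by
      ext z
      have q := p z
      have q' := p' z
      grind
    rw [this]
    exact (h.closed_left.union h'.closed_right).union hw.closed_right

/-- Of two half cuts with the same trace, the cut points cannot lie on the same side of each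
other. -/
theorem notMem_of_mem (hw : IsWall L E M) (h : IsHalfCut L E x P A B)
    (hx : ¬ IsCutPoint x) (h' : IsHalfCut L E x' P A' B') (hx' : ¬ IsCutPoint x')
    (hP : (E \ P).Nonempty) {A₁ B₁ : Set X}
    (h₁ : IsHalfCut M E y P A₁ B₁) (hy : ¬ IsCutPoint y) (hx'A : x' ∈ A) : x ∉ A' := by
  intro hxA'
  have e := h.nested hw h₁.mem hx h' hx'A
  have e' := h'.nested hw h₁.mem hx' h hxA'
  have p := h.pointwise hw
  have p' := h'.pointwise hw
  have p₁ := h₁.pointwise hw.symm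
  -- Nesting both ways gives `B ⊆ B'`, while `x ∈ A'` keeps `x` out of `B' ∪ {x'}`.
  have hB : IsClosed B := by
    have : B = (B ∪ {x}) ∩ (B' ∪ {x'}) := by
      ext z
      have q := p z
      have q' := p' z
      have e1 := Set.ext_iff.1 e z
      have e1' := Set.ext_iff.1 e' z
      have h1 : z = x' → z ∈ A := by rintro rfl; exact hx'A
      have h2 : z = x → z ∈ A' := by rintro rfl; exact hxA'
      grind
    rw [this]
    exact h.closed_right.inter h'.closed_right
  have hxM : x ∉ M := fun hm => Set.disjoint_left.1 hw.left_right h.mem hm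
  have hyL : y ∉ L := fun hm => Set.disjoint_left.1 hw.left_right hm h₁.mem
  -- `B` and the far piece `B₁` fit together along `E \ P`, so `y` alone would cut off their union.
  have key : B ∪ B₁ = ∅ := by
    refine eq_empty_of_not_isCutPoint hy (y := x) ?_ ?_ ?_ ?_ ?_
    · rintro rfl; exact hyL h.mem
    · have q := p y
      have q1 := p₁ y
      grind
    · have q := p x
      have q1 := p₁ x
      grind
    · rw [Set.union_assoc]
      exact hB.union h₁.closed_right
    · have : (B ∪ B₁)ᶜ = (A ∪ {x}) ∪ (A₁ ∪ {y}) := by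
        ext z
        have q := p z
        have q1 := p₁ z
        grind
      rw [this]
      exact h.closed_left.union h₁.closed_left
  obtain ⟨z, hzE, hzP⟩ := hP
  have q := p z
  have e1 := Set.ext_iff.1 key z
  grind

/-- Half cuts with equal traces whose cut points lie on different sides of `x` give a cut pair
on both sides of `x`. -/
theorem isCutSet_pair (hw : IsWall L E M) (hy : y ∈ M) (h : IsHalfCut L E x P A B)
    (h' : IsHalfCut L E x' P A' B') (h'' : IsHalfCut L E x'' P A'' B'')
    (hx' : x ∈ B') (hx'' : x ∈ A'') : IsCutSet ({x', x''} : Set X) := by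
  have p := h.pointwise hw
  have p' := h'.pointwise hw
  have p'' := h''.pointwise hw
  -- Equal traces keep `B' ∩ A''` off the wall, so it is clopen in the complement of `{x', x''}`; it
  -- contains `x` but not `y`.
  refine IsCutPartition.isCutSet (A := B' ∩ A'') (B := (B' ∩ A'' ∪ {x', x''})ᶜ)
    ⟨?_, ?_, ⟨x, hx', hx''⟩, ⟨y, ?_⟩, ?_, ?_⟩
  · exact Set.disjoint_left.2 fun z h h' => h' (Or.inl h)
  · ext z
    have q' := p' z
    have q'' := p'' z
    grind
  · have q := p y
    have q' := p' y
    have q'' := p'' y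
    grind
  · have : B' ∩ A'' ∪ {x', x''} = ((B' ∪ {x'}) ∪ {x''}) ∩ ((A'' ∪ {x''}) ∪ {x'}) := by
      ext z
      grind
    rw [this]
    have cl : ∀ {x P A B}, IsHalfCut L E x P A B → IsClosed ({x} : Set X) := by
      intro x P A B h
      have p := h.pointwise hw
      have : ({x} : Set X) = (A ∪ {x}) ∩ (B ∪ {x}) := by
        ext z
        have q := p z
        grind
      rw [this]
      exact h.closed_left.inter h.closed_right
    exact (h'.closed_right.union (cl h'')).inter (h''.closed_left.union (cl h'))
  · have : (B' ∩ A'' ∪ {x', x''})ᶜ ∪ {x', x''} = (A' ∪ {x'}) ∪ (B'' ∪ {x''}) ∪ (M ∪ E) := by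
      ext z
      have q' := p' z
      have q'' := p'' z
      grind
    rw [this]
    exact (h'.closed_left.union h''.closed_right).union hw.closed_right

end IsHalfCut

namespace IsCutPartition
variable {L E M : Set X} {x y : X} {A B : Set X}

theorem isHalfCut (hw : IsWall L E M) (hx : x ∈ L) (hy : y ∈ M)
    (h : IsCutPartition {x, y} A B) :
    IsHalfCut L E x (A ∩ E) (A ∩ (L ∪ E)) (B ∩ (L ∪ E)) := by
  have hyL : y ∉ L ∪ E := by
    rintro (h1 | h1)
    · exact Set.disjoint_left.1 hw.left_right h1 hy
    · exact Set.disjoint_left.1 hw.wall_right h1 hy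
  have hu : ∀ z, (z ∈ A ∨ z ∈ B) ↔ ¬ (z = x ∨ z = y) := fun z => Set.ext_iff.1 h.union z
  refine ⟨hx, ?_, ?_, ?_, ?_, ?_⟩
  · exact h.disjoint.mono Set.inter_subset_left Set.inter_subset_left
  · ext z
    have := hu z
    grind
  · have : A ∩ (L ∪ E) ∪ {x} = (A ∪ {x, y}) ∩ (L ∪ E) := by
      ext z
      grind
    rw [this]
    exact h.closed_left.inter hw.closed_left
  · have : B ∩ (L ∪ E) ∪ {x} = (B ∪ {x, y}) ∩ (L ∪ E) := by
      ext z
      grind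
    rw [this]
    exact h.closed_right.inter hw.closed_left
  · ext z
    grind

/-- Without a trace on the wall, `A ∩ L` could be cut off by `x` alone. -/
theorem inter_side_eq_empty (hw : IsWall L E M) (hx : x ∈ L) (hy : y ∈ M)
    (h : IsCutPartition {x, y} A B) (hcx : ¬ IsCutPoint x) (hE : A ∩ E = ∅) :
    A ∩ L = ∅ := by
  have hh := h.isHalfCut hw hx hy
  have p := hh.pointwise hw
  have hu : ∀ z, (z ∈ A ∨ z ∈ B) ↔ ¬ (z = x ∨ z = y) := fun z => Set.ext_iff.1 h.union z
  have hd : ∀ z, z ∈ A → z ∉ B := fun z a => Set.disjoint_left.1 h.disjoint a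
  have hE' : ∀ z, z ∈ A → z ∉ E := fun z a b => (Set.ext_iff.1 hE z).1 ⟨a, b⟩
  refine eq_empty_of_not_isCutPoint hcx (y := y) ?_ ?_ ?_ ?_ ?_
  · rintro rfl; exact Set.disjoint_left.1 hw.left_right hx hy
  · have := hu x
    grind
  · have := hu y
    grind
  · have : A ∩ L ∪ {x} = A ∩ (L ∪ E) ∪ {x} := by
      ext z
      have := hE' z
      grind
    rw [this]
    exact hh.closed_left
  · have : (A ∩ L)ᶜ = (B ∪ {x, y}) ∪ (M ∪ E) := by
      ext z
      have q := p z
      have := hu z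
      have := hd z
      have := hE' z
      grind
    rw [this]
    exact h.closed_right.union hw.closed_right

theorem inter_wall_nonempty (hw : IsWall L E M) (hx : x ∈ L) (hy : y ∈ M)
    (h : IsCutPartition {x, y} A B) (hcx : ¬ IsCutPoint x) (hcy : ¬ IsCutPoint y) :
    (A ∩ E).Nonempty := by
  by_contra hE
  rw [Set.not_nonempty_iff_eq_empty] at hE
  have h1 := h.inter_side_eq_empty hw hx hy hcx hE
  have h2 := (Set.pair_comm x y ▸ h).inter_side_eq_empty hw.symm hy hx hcy hE
  obtain ⟨z, hz⟩ := h.nonempty_left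
  have := Set.ext_iff.1 hw.union z
  have := Set.ext_iff.1 h1 z
  have := Set.ext_iff.1 h2 z
  have := Set.ext_iff.1 hE z
  grind

end IsCutPartition

/-- The uncrossed cut pairs `{x, y}` separated by the wall `E`, together with a partition that
cuts `E` into `P` and the rest. -/
structure IsUncrossedAcross (L E M P : Set X) (x y : X) (A B : Set X) : Prop where
  left : x ∈ L
  right : y ∈ M
  uncrossed : IsUncrossedCutPair ({x, y} : Set X)
  partition : IsCutPartition {x, y} A B
  trace : A ∩ E = P

theorem IsCutPair.not_isCutPoint {x y : X} (h : IsCutPair ({x, y} : Set X)) :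
    ¬ IsCutPoint x ∧ ¬ IsCutPoint y := by
  obtain ⟨-, p, q, -, hpq, hp, hq⟩ := h
  have h1 : x ∈ ({p, q} : Set X) := hpq ▸ Or.inl rfl
  have h2 : y ∈ ({p, q} : Set X) := hpq ▸ Or.inr rfl
  rw [Set.mem_insert_iff, Set.mem_singleton_iff] at h1 h2
  constructor
  · rcases h1 with rfl | rfl <;> assumption
  · rcases h2 with rfl | rfl <;> assumption

namespace IsUncrossedAcross
variable {L E M P : Set X} {x y x' y' x'' y'' : X} {A B A' B' A'' B'' : Set X}

theorem swap (h : IsUncrossedAcross L E M P x y A B) : IsUncrossedAcross M E L P y x A B :=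
  ⟨h.right, h.left, Set.pair_comm x y ▸ h.uncrossed, Set.pair_comm x y ▸ h.partition, h.trace⟩

theorem not_isCutPoint (h : IsUncrossedAcross L E M P x y A B) : ¬ IsCutPoint x :=
  h.uncrossed.1.not_isCutPoint.1

theorem isHalfCut (hw : IsWall L E M) (h : IsUncrossedAcross L E M P x y A B) :
    IsHalfCut L E x P (A ∩ (L ∪ E)) (B ∩ (L ∪ E)) := by
  have := h.partition.isHalfCut hw h.left h.right
  rwa [h.trace] at this

theorem symm (hw : IsWall L E M) (h : IsUncrossedAcross L E M P x y A B) :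
    IsUncrossedAcross L E M (E \ P) x y B A := by
  refine ⟨h.left, h.right, h.uncrossed, h.partition.symm, ?_⟩
  have := ((h.isHalfCut hw).symm hw).trace
  rwa [Set.inter_assoc, Set.inter_eq_right.2 Set.subset_union_right] at this

theorem trace_nonempty (hw : IsWall L E M) (h : IsUncrossedAcross L E M P x y A B) :
    P.Nonempty := by
  rw [← h.trace]
  exact h.partition.inter_wall_nonempty hw h.left h.right h.not_isCutPoint h.swap.not_isCutPoint

theorem notMem_of_mem (hw : IsWall L E M) (h : IsUncrossedAcross L E M P x y A B)
    (h' : IsUncrossedAcross L E M P x' y' A' B') (hx' : x' ∈ A) : x ∉ A' := fun hx =>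
  (h.isHalfCut hw).notMem_of_mem hw h.not_isCutPoint (h'.isHalfCut hw) h'.not_isCutPoint
    ((h.symm hw).trace_nonempty hw) (h.swap.isHalfCut hw.symm) h.swap.not_isCutPoint
    ⟨hx', Or.inl h'.left⟩ ⟨hx, Or.inl h.left⟩

theorem mem_or_mem (hw : IsWall L E M) (h : IsUncrossedAcross L E M P x y A B)
    (h' : IsUncrossedAcross L E M P x' y' A' B') (hne : x' ≠ x) : x' ∈ A ∨ x' ∈ B := by
  have hu : (x' ∈ A ∨ x' ∈ B) ↔ ¬ (x' = x ∨ x' = y) := Set.ext_iff.1 h.partition.union x'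
  rw [hu]
  rintro (h1 | h1)
  · exact hne h1
  · exact Set.disjoint_left.1 hw.left_right h'.left (h1 ▸ h.right)

/-- The first point of an uncrossed cut pair is extremal. -/
theorem extremal (hw : IsWall L E M) (h : IsUncrossedAcross L E M P x y A B)
    (h' : IsUncrossedAcross L E M P x' y' A' B')
    (h'' : IsUncrossedAcross L E M P x'' y'' A'' B'') (hx' : x' ∈ A) (hx'' : x'' ∈ B) :
    False := by
  have ne : ∀ {z}, z ∈ A ∨ z ∈ B → x ≠ z ∧ z ∈ ({x, y} : Set X)ᶜ := by
    intro z hz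
    have hz' : z ∈ ({x, y} : Set X)ᶜ := h.partition.union ▸ hz
    exact ⟨fun e => hz' (Or.inl e.symm), hz'⟩
  have n' := ne (Or.inl hx')
  have n'' := ne (Or.inr hx'')
  have h1 := h.notMem_of_mem hw h' hx'
  have h2 := (h.symm hw).notMem_of_mem hw (h''.symm hw) hx''
  have h3 := (h'.mem_or_mem hw h n'.1).resolve_left h1
  have h4 := (h''.mem_or_mem hw h n''.1).resolve_right h2
  -- Here `x` lies in `B'` and in `A''`, so `{x', x''}` is a cut pair; its points lie in `A` and
  -- `B`, so it crosses `{x, y}`.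
  refine h.uncrossed.2 {x', x''} ⟨?_, x', x'', ?_, rfl, h'.not_isCutPoint, h''.not_isCutPoint⟩
    ⟨x', x'', rfl, n'.2, n''.2, h.partition.notMem_connectedComponentIn hx' hx''⟩
  · exact IsHalfCut.isCutSet_pair hw h.right (h.isHalfCut hw) (h'.isHalfCut hw)
      (h''.isHalfCut hw) ⟨h3, Or.inl h.left⟩ ⟨h4, Or.inl h.left⟩
  · rintro rfl
    exact Set.disjoint_left.1 h.partition.disjoint hx' hx''

/-- There are at most two such points: by `extremal` all the others lie in `A` or all lie in `B`,
and `notMem_of_mem` allows one point of each kind. Replacing `P` by `E \ P` exchanges the kinds. -/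
theorem finite_left (hw : IsWall L E M) (P : Set X) :
    {x | ∃ y A B, IsUncrossedAcross L E M P x y A B}.Finite := by
  have sub : ∀ P, {x | ∃ y A B, IsUncrossedAcross L E M P x y A B ∧ ∀ x' y' A' B',
      IsUncrossedAcross L E M P x' y' A' B' → x' ≠ x → x' ∈ A}.Subsingleton := by
    rintro P x ⟨y, A, B, h, hall⟩ x' ⟨y', A', B', h', hall'⟩
    by_contra hne
    exact h.notMem_of_mem hw h' (hall _ _ _ _ h' (Ne.symm hne)) (hall' _ _ _ _ h hne)
  refine ((sub P).finite.union (sub (E \ P)).finite).subset ?_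
  rintro x ⟨y, A, B, h⟩
  by_cases hall : ∀ x' y' A' B', IsUncrossedAcross L E M P x' y' A' B' → x' ≠ x → x' ∈ A
  · exact Or.inl ⟨y, A, B, h, hall⟩
  · push Not at hall
    obtain ⟨p, q, C, D, hp, hpx, hpA⟩ := hall
    have hpB := (h.mem_or_mem hw hp hpx).resolve_left hpA
    refine Or.inr ⟨y, B, A, h.symm hw, fun x' y' A' B' h' hne => ?_⟩
    have h'' := h'.symm hw
    rw [Set.sdiff_sdiff_right_self] at h''
    have : E ∩ P = P := Set.inter_eq_right.2 (h.trace ▸ Set.inter_subset_right)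
    rw [this] at h''
    exact (h.mem_or_mem hw h'' hne).resolve_left fun hA => h.extremal hw h'' hp hA hpB

end IsUncrossedAcross

/-- Only finitely many uncrossed cut pairs are separated by a finite wall. -/
theorem finite_uncrossed_across_wall [T1Space X] {L E M : Set X} (hw : IsWall L E M)
    (hE : E.Finite) :
    {S : Set X | IsUncrossedCutPair S ∧ ∃ x ∈ L, ∃ y ∈ M, S = {x, y}}.Finite := by
  refine (hE.finite_subsets.biUnion fun P _ =>
    (IsUncrossedAcross.finite_left hw P).image2 (fun x y => ({x, y} : Set X))
      (IsUncrossedAcross.finite_left hw.symm P)).subset ?_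
  rintro S ⟨hS, x, hx, y, hy, rfl⟩
  obtain ⟨A, B, hAB⟩ := hS.1.1.exists_partition (Set.toFinite _).isClosed
  have h : IsUncrossedAcross L E M (A ∩ E) x y A B := ⟨hx, hy, hS, hAB, rfl⟩
  exact Set.mem_biUnion (x := A ∩ E) Set.inter_subset_right
    ⟨x, ⟨y, A, B, h⟩, y, ⟨x, A, B, h.swap⟩, rfl⟩

end CutSets

/-! ### Topology of the boundary and continuity of the action. -/

namespace FreeBoundary
section
variable {α : Type*}

theorem continuous_coord (n : ℕ) :
    @Continuous _ _ _ ⊥ (fun ξ : FreeBoundary α => ξ.1 n) := by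
  let _ : TopologicalSpace (α × Bool) := ⊥
  exact (continuous_apply n).comp continuous_induced_dom

theorem continuous_of_coord {Y : Type*} [TopologicalSpace Y] {f : Y → FreeBoundary α}
    (h : ∀ n, @Continuous _ _ _ ⊥ (fun y => (f y).1 n)) : Continuous f := by
  let _ : TopologicalSpace (α × Bool) := ⊥
  exact continuous_induced_rng.2 (continuous_pi h)

theorem isClopen_coord (n : ℕ) (P : Set (α × Bool)) :
    IsClopen {ξ : FreeBoundary α | ξ.1 n ∈ P} := by
  let _ : TopologicalSpace (α × Bool) := ⊥
  have _ : DiscreteTopology (α × Bool) := ⟨rfl⟩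
  exact (isClopen_discrete P).preimage (continuous_coord n)

instance : T2Space (FreeBoundary α) := by
  let _ : TopologicalSpace (α × Bool) := ⊥
  have _ : DiscreteTopology (α × Bool) := ⟨rfl⟩
  exact T2Space.of_injective_continuous (f := fun ξ : FreeBoundary α => ξ.1)
    Subtype.val_injective continuous_induced_dom

instance [Finite α] : CompactSpace (FreeBoundary α) := by
  let _ : TopologicalSpace (α × Bool) := ⊥
  have _ : DiscreteTopology (α × Bool) := ⟨rfl⟩
  refine Topology.IsClosedEmbedding.compactSpace (f := fun ξ : FreeBoundary α => ξ.1)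
    ⟨⟨⟨rfl⟩, Subtype.val_injective⟩, ?_⟩
  have : Set.range (fun ξ : FreeBoundary α => ξ.1) =
      ⋂ n, {ξ : ℕ → α × Bool | ξ (n + 1) ≠ letterInv (ξ n)} := by
    ext ξ
    simp only [Set.mem_range, Set.mem_iInter]
    exact ⟨by rintro ⟨η, rfl⟩; exact η.2, fun h => ⟨⟨ξ, h⟩, rfl⟩⟩
  rw [this]
  refine isClosed_iInter fun n => ?_
  have hc : Continuous fun ξ : ℕ → α × Bool => (ξ (n + 1), ξ n) := by fun_prop
  exact (isClosed_discrete {p : (α × Bool) × (α × Bool) | p.1 ≠ letterInv p.2}).preimage hc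

/-- A neighbourhood of a boundary point contains all rays sharing a long initial segment. -/
theorem exists_agree_subset {U : Set (FreeBoundary α)} (hU : IsOpen U) {ξ : FreeBoundary α}
    (hξ : ξ ∈ U) : ∃ d, ∀ η : FreeBoundary α, (∀ k < d, η.1 k = ξ.1 k) → η ∈ U := by
  let _ : TopologicalSpace (α × Bool) := ⊥
  obtain ⟨V, hV, rfl⟩ := isOpen_induced_iff.1 hU
  obtain ⟨I, u, hu, hsub⟩ := isOpen_pi_iff.1 hV _ hξ
  refine ⟨I.sup id + 1, fun η hη => hsub fun i hi => ?_⟩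
  have h1 : η.1 i = ξ.1 i := hη i (Nat.lt_succ_of_le (Finset.le_sup (f := id) hi))
  exact Set.mem_of_eq_of_mem h1 (hu i hi).2

/-- A clopen subset of the boundary is determined by finitely many letters. -/
theorem exists_depth [Finite α] {U : Set (FreeBoundary α)} (hU : IsClopen U) :
    ∃ d, ∀ ξ η : FreeBoundary α, (∀ k < d, η.1 k = ξ.1 k) → (ξ ∈ U ↔ η ∈ U) := by
  -- The rays for which `d` letters decide membership form open sets that increase with `d` and
  -- cover a compact space.
  have key := (isCompact_univ (X := FreeBoundary α)).elim_directed_cover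
    (fun d : ℕ => {ξ : FreeBoundary α | ∀ η : FreeBoundary α, (∀ k < d, η.1 k = ξ.1 k) →
      (ξ ∈ U ↔ η ∈ U)})
  refine (key ?_ ?_ ?_).imp fun d hd ξ => hd (Set.mem_univ ξ)
  · intro d
    rw [isOpen_iff_mem_nhds]
    intro ξ hξ
    have : (⋂ k ∈ Finset.range d, {η : FreeBoundary α | η.1 k ∈ ({ξ.1 k} : Set _)}) ∈ nhds ξ :=
      (Filter.biInter_finset_mem _).2 fun k _ => (isClopen_coord k _).isOpen.mem_nhds rfl
    filter_upwards [this] with η hη ζ hζ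
    have hη' : ∀ k < d, η.1 k = ξ.1 k := fun k hk => by
      have := Set.mem_iInter₂.1 hη k (Finset.mem_range.2 hk)
      exact this
    rw [← hξ η hη', hξ ζ fun k hk => (hζ k hk).trans (hη' k hk)]
  · intro ξ _
    rw [Set.mem_iUnion]
    by_cases h : ξ ∈ U
    · obtain ⟨d, hd⟩ := exists_agree_subset hU.isOpen h
      exact ⟨d, fun η hη => iff_of_true h (hd η hη)⟩
    · obtain ⟨d, hd⟩ := exists_agree_subset hU.compl.isOpen h
      exact ⟨d, fun η hη => iff_of_false h (hd η hη)⟩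
  · refine directed_of_isDirected_le fun d e hde ξ hξ η hη => ?_
    exact hξ η fun k hk => hη k (hk.trans_le hde)

theorem mk_letterInv (s : α × Bool) :
    (FreeGroup.mk [letterInv s] : FreeGroup α) = (FreeGroup.mk [s])⁻¹ := by
  rw [FreeGroup.inv_mk]; rfl

variable [DecidableEq α]

theorem letterMul_of_eq {s : α × Bool} {ξ : FreeBoundary α} (h : ξ.1 0 = letterInv s) :
    letterMul s ξ = ξ.tail := dif_pos h

theorem letterMul_of_ne {s : α × Bool} {ξ : FreeBoundary α} (h : ξ.1 0 ≠ letterInv s) :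
    letterMul s ξ = cons s ξ h := dif_neg h

theorem continuous_letterMul (s : α × Bool) : Continuous (letterMul s) := by
  let _ : TopologicalSpace (α × Bool) := ⊥
  have _ : DiscreteTopology (α × Bool) := ⟨rfl⟩
  refine continuous_of_coord fun n => ?_
  cases n with
  | zero =>
    have : (fun ξ : FreeBoundary α => (letterMul s ξ).1 0) =
        fun ξ => (fun p : (α × Bool) × (α × Bool) => if p.1 = letterInv s then p.2 else s)
          (ξ.1 0, ξ.1 1) := by
      funext ξ
      by_cases h : ξ.1 0 = letterInv s
      · simp only [letterMul_of_eq h, if_pos h]; rfl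
      · simp only [letterMul_of_ne h, if_neg h]; rfl
    rw [this]
    exact (continuous_of_discreteTopology (f := fun p : (α × Bool) × (α × Bool) =>
      if p.1 = letterInv s then p.2 else s)).comp ((continuous_coord 0).prodMk (continuous_coord 1))
  | succ n =>
    have : (fun ξ : FreeBoundary α => (letterMul s ξ).1 (n + 1)) =
        fun ξ => (fun p : (α × Bool) × (α × Bool) × (α × Bool) =>
          if p.1 = letterInv s then p.2.1 else p.2.2) (ξ.1 0, ξ.1 (n + 2), ξ.1 n) := by
      funext ξ
      by_cases h : ξ.1 0 = letterInv s
      · simp only [letterMul_of_eq h, if_pos h]; rfl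
      · simp only [letterMul_of_ne h, if_neg h]; rfl
    rw [this]
    exact (continuous_of_discreteTopology (f := fun p : (α × Bool) × (α × Bool) × (α × Bool) =>
      if p.1 = letterInv s then p.2.1 else p.2.2)).comp ((continuous_coord 0).prodMk ((continuous_coord (n + 2)).prodMk (continuous_coord n)))

theorem mk_singleton_smul (s : α × Bool) (ξ : FreeBoundary α) :
    FreeGroup.mk [s] • ξ = letterMul s ξ := by
  change FreeGroup.lift (genPerm (α := α)) (FreeGroup.mk [s]) ξ = _
  obtain ⟨a, b⟩ := s
  cases b <;> simp <;> rfl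

theorem mk_singleton_inv_smul (s : α × Bool) (ξ : FreeBoundary α) :
    (FreeGroup.mk [s])⁻¹ • ξ = letterMul (letterInv s) ξ := by
  rw [← mk_letterInv, mk_singleton_smul]

instance : ContinuousConstSMul (FreeGroup α) (FreeBoundary α) where
  continuous_const_smul g := by
    induction g using FreeGroup.induction_on with
    | C1 => simpa using continuous_id'
    | of a =>
      exact (continuous_letterMul (a, true)).congr fun ξ => (mk_singleton_smul (a, true) ξ).symm
    | inv_of a _ =>
      exact (continuous_letterMul (a, false)).congr fun ξ =>
        (mk_singleton_inv_smul (a, true) ξ).symm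
    | mul x y hx hy => exact (hx.comp hy).congr fun ξ => (mul_smul x y ξ).symm

theorem letterMul_letterInv_self_apply {s : α × Bool} {ξ : FreeBoundary α} (h : ξ.1 0 = s)
    (n : ℕ) : (letterMul (letterInv s) ξ).1 n = ξ.1 (n + 1) := by
  rw [letterMul_of_eq (by rw [h, letterInv_letterInv])]; rfl

theorem letterMul_letterInv_apply_zero {s : α × Bool} {ξ : FreeBoundary α} (h : ξ.1 0 ≠ s) :
    (letterMul (letterInv s) ξ).1 0 = letterInv s := by
  rw [letterMul_of_ne (by rwa [letterInv_letterInv])]; rfl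

theorem letterMul_letterInv_apply_succ {s : α × Bool} {ξ : FreeBoundary α} (h : ξ.1 0 ≠ s)
    (n : ℕ) : (letterMul (letterInv s) ξ).1 (n + 1) = ξ.1 n := by
  rw [letterMul_of_ne (by rwa [letterInv_letterInv])]; rfl

/-- The `n`-th vertex of the ray from the identity to `ξ`. -/
def rayVertex (ξ : FreeBoundary α) : ℕ → FreeGroup α
  | 0 => 1
  | n + 1 => rayVertex ξ n * FreeGroup.mk [ξ.1 n]

theorem rayVertex_succ_inv_smul (ξ η : FreeBoundary α) (n : ℕ) :
    (rayVertex ξ (n + 1))⁻¹ • η = letterMul (letterInv (ξ.1 n)) ((rayVertex ξ n)⁻¹ • η) := by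
  rw [rayVertex, mul_inv_rev, mul_smul, mk_singleton_inv_smul]

/-- Along an initial segment shared with `ξ`, translating back removes that segment. -/
theorem rayVertex_inv_smul_apply {ξ η : FreeBoundary α} {n : ℕ} (h : ∀ k < n, η.1 k = ξ.1 k)
    (m : ℕ) : ((rayVertex ξ n)⁻¹ • η).1 m = η.1 (n + m) := by
  induction n generalizing m with
  | zero => simp [rayVertex]
  | succ n ih =>
    have ih' := ih fun k hk => h k (hk.trans n.lt_succ_self)
    rw [rayVertex_succ_inv_smul, letterMul_letterInv_self_apply, ih']
    · rw [Nat.add_assoc, Nat.add_comm 1]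
    · rw [ih', Nat.add_zero, h n n.lt_succ_self]

end
end FreeBoundary

/-! ### Word length and branches at the identity. -/

section Words
variable {α : Type*} [DecidableEq α]

/-- In different branches nothing cancels: the geodesic from `u` to `v` passes through the identity.
-/
theorem FreeGroup.norm_inv_mul_of_head_ne {u v : FreeGroup α}
    (h : ∀ a ∈ u.toWord.head?, a ∉ v.toWord.head?) : (u⁻¹ * v).norm = u.norm + v.norm := by
  have hred : FreeGroup.IsReduced (FreeGroup.invRev u.toWord ++ v.toWord) := by
    refine List.isChain_append.2 ⟨?_, FreeGroup.isReduced_toWord, ?_⟩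
    · rw [← FreeGroup.toWord_inv]; exact FreeGroup.isReduced_toWord
    · intro x hx y hy hxy
      rw [FreeGroup.invRev, List.getLast?_reverse, List.head?_map] at hx
      simp only [Option.mem_def, Option.map_eq_some_iff] at hx
      obtain ⟨a, ha, rfl⟩ := hx
      by_contra hne
      refine h a ha ?_
      have : y = a := Prod.ext hxy.symm (by
        simp only at hne
        cases h1 : a.2 <;> cases h2 : y.2 <;> simp_all)
      rwa [← this]
  rw [FreeGroup.norm, FreeGroup.toWord_mul, FreeGroup.toWord_inv, hred.reduce_eq,
    List.length_append, FreeGroup.invRev_length]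
  rfl

theorem FreeGroup.head_eq_of_norm_lt {u v : FreeGroup α} (h : (u⁻¹ * v).norm < u.norm) :
    v.toWord.head? = u.toWord.head? := by
  by_contra hne
  refine absurd (FreeGroup.norm_inv_mul_of_head_ne (u := u) (v := v) ?_) (by omega)
  intro a ha ha'
  rw [Option.mem_def] at ha ha'
  exact hne (ha'.trans ha.symm)

theorem FreeGroup.norm_pow_le (w : FreeGroup α) (i : ℕ) : (w ^ i).norm ≤ i * w.norm := by
  induction i with
  | zero => simp
  | succ i ih =>
    rw [pow_succ, Nat.succ_mul]
    exact (FreeGroup.norm_mul_le _ _).trans (Nat.add_le_add_right ih _)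

theorem FreeGroup.finite_norm_le [Finite α] (K : ℕ) : {g : FreeGroup α | g.norm ≤ K}.Finite :=
  (List.finite_length_le (α × Bool) K).preimage (FreeGroup.toWord_injective.injOn)

end Words

/-! ### Axes and their ends. -/

namespace FreeBoundary
variable {α : Type*} [DecidableEq α] {u : ℕ → FreeGroup α} {ξ η ζ : FreeBoundary α}
  {g h w v : FreeGroup α}

theorem VertexLimit.eventually_head (hu : VertexLimit u ξ) :
    ∀ᶠ i in atTop, (u i).toWord.head? = some (ξ.1 0) := by
  filter_upwards [hu 1] with i hi
  cases hw : (u i).toWord with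
  | nil => simp [hw] at hi
  | cons t l =>
    rw [hw] at hi
    simpa using hi

theorem VertexLimit.eventually_le_norm (hu : VertexLimit u ξ) (n : ℕ) :
    ∀ᶠ i in atTop, n ≤ (u i).norm := by
  filter_upwards [hu n] with i hi
  have := congrArg List.length hi
  simp only [List.length_take, List.length_map, List.length_range] at this
  rw [FreeGroup.norm]
  omega

theorem VertexLimit.comp (hu : VertexLimit u ξ) {φ : ℕ → ℕ} (hφ : Tendsto φ atTop atTop) :
    VertexLimit (fun i => u (φ i)) ξ := fun n => hφ.eventually (hu n)

/-- Points of the boundary with distinct rays have translates with distinct first letters. -/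
theorem exists_smul_head_ne (hne : ξ ≠ η) : ∃ g : FreeGroup α, (g • ξ).1 0 ≠ (g • η).1 0 := by
  have hex : ∃ n, ξ.1 n ≠ η.1 n := by
    by_contra hcon
    push Not at hcon
    exact hne (Subtype.ext (funext hcon))
  have hlt : ∀ k < Nat.find hex, η.1 k = ξ.1 k := fun k hk => by
    have := Nat.find_min hex hk
    push Not at this
    exact this.symm
  refine ⟨(rayVertex ξ (Nat.find hex))⁻¹, ?_⟩
  rw [rayVertex_inv_smul_apply (fun _ _ => rfl), rayVertex_inv_smul_apply hlt]
  exact Nat.find_spec hex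

/-- Sequences of vertices at bounded distance have the same limit. -/
theorem VertexLimit.eq_of_mul_right (hu : VertexLimit u ξ) {c : FreeGroup α}
    (hv : VertexLimit (fun i => u i * c) η) : ξ = η := by
  by_contra hne
  -- After a translation the limits start with different letters, yet far from the identity two
  -- vertices at distance `c.norm` lie in the same branch.
  obtain ⟨g, hg⟩ := exists_smul_head_ne hne
  obtain ⟨i, h1, h2, h3⟩ := ((hu.smul g).eventually_head.and
    ((hv.smul g).eventually_head.and ((hu.smul g).eventually_le_norm (c.norm + 1)))).exists
  have := FreeGroup.head_eq_of_norm_lt (u := g * u i) (v := g * (u i * c)) (by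
    rw [show (g * u i)⁻¹ * (g * (u i * c)) = c by group]; omega)
  rw [h1, h2, Option.some_inj] at this
  exact hg this.symm

theorem VertexLimit.unique (hu : VertexLimit u ξ) (hv : VertexLimit u η) : ξ = η :=
  hu.eq_of_mul_right (c := 1) (by simpa using hv)

theorem IsAxisEnd.smul (hξ : IsAxisEnd g w ξ) (k : FreeGroup α) :
    IsAxisEnd (k * g) w (k • ξ) := by
  have := VertexLimit.smul hξ k
  simpa only [IsAxisEnd, mul_assoc] using this

theorem IsAxisEnd.shift (hξ : IsAxisEnd g w ξ) (i : ℕ) : IsAxisEnd (g * w ^ i) w ξ := by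
  have := hξ.comp (φ := fun k => i + k) (tendsto_atTop_mono (fun k => Nat.le_add_left k i)
    tendsto_id)
  simpa only [IsAxisEnd, pow_add, mul_assoc] using this

theorem IsAxisEnd.shift_inv (hξ : IsAxisEnd g w⁻¹ ξ) (i : ℕ) :
    IsAxisEnd (g * w ^ i) w⁻¹ ξ := by
  have h1 : VertexLimit _ ξ := hξ.comp (tendsto_sub_atTop_nat i)
  intro n
  filter_upwards [h1 n, eventually_ge_atTop i] with k hk hik
  rw [← hk]
  congr 2
  obtain ⟨m, rfl⟩ := Nat.exists_eq_add_of_le hik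
  rw [Nat.add_sub_cancel_left, pow_add]
  group

/-- Either the axis comes close to the identity or it stays in one branch of the tree. -/
theorem IsAxisEnd.near_or_head (hξ : IsAxisEnd g w ξ) :
    (∃ i : ℕ, (g * w ^ i).norm ≤ w.norm) ∨ g.toWord.head? = some (ξ.1 0) := by
  by_contra hcon
  push Not at hcon
  obtain ⟨hfar, hne⟩ := hcon
  -- Steps of length `w.norm` taken farther than that from the identity cannot change branch.
  have hc : ∀ i : ℕ, (g * w ^ i).toWord.head? = g.toWord.head? := by
    intro i
    induction i with
    | zero => simp
    | succ i ih =>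
      rw [← ih]
      refine FreeGroup.head_eq_of_norm_lt ?_
      rw [show (g * w ^ i)⁻¹ * (g * w ^ (i + 1)) = w by rw [pow_succ]; group]
      exact hfar i
  obtain ⟨i, hi⟩ := (VertexLimit.eventually_head hξ).exists
  exact hne ((hc i).symm.trans hi)

theorem toWord_rayVertex (ξ : FreeBoundary α) (n : ℕ) :
    (rayVertex ξ n).toWord = (List.range n).map ξ.1 := by
  have hred : FreeGroup.IsReduced ((List.range n).map ξ.1) := by
    refine List.isChain_iff_getElem.2 fun i hi hfst => ?_
    simp only [List.getElem_map, List.getElem_range] at hfst ⊢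
    have h1 := ξ.2 i
    by_contra hne
    refine h1 (Prod.ext hfst.symm ?_)
    cases h2 : (ξ.1 i).2 <;> cases h3 : (ξ.1 (i + 1)).2 <;> simp_all [letterInv]
  have hmk : rayVertex ξ n = FreeGroup.mk ((List.range n).map ξ.1) := by
    clear hred
    induction n with
    | zero => rfl
    | succ n ih => rw [rayVertex, ih, FreeGroup.mul_mk, List.range_succ, List.map_append]; rfl
  rw [hmk, FreeGroup.toWord_mk, hred.reduce_eq]

theorem norm_rayVertex (ξ : FreeBoundary α) (n : ℕ) : (rayVertex ξ n).norm = n := by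
  rw [FreeGroup.norm, toWord_rayVertex]; simp

/-- An axis passes close to all but finitely many vertices of a ray to its end. -/
theorem IsAxisEnd.exists_near_rayVertex (hξ : IsAxisEnd g w ξ) {n : ℕ} (hn : g.norm < n) :
    ∃ i : ℕ, ((rayVertex ξ n)⁻¹ * (g * w ^ i)).norm ≤ w.norm := by
  rcases (hξ.smul (rayVertex ξ n)⁻¹).near_or_head with ⟨i, hi⟩ | hhead
  · exact ⟨i, by rwa [mul_assoc] at hi⟩
  -- If `g` lay ahead of the `n`-th vertex of the ray, the geodesic from the identity to `g` would
  -- pass through that vertex, forcing `n ≤ g.norm`.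
  · exfalso
    rw [rayVertex_inv_smul_apply (fun _ _ => rfl), Nat.add_zero] at hhead
    obtain ⟨m, rfl⟩ : ∃ m, n = m + 1 := ⟨n - 1, by omega⟩
    have := FreeGroup.norm_inv_mul_of_head_ne (u := (rayVertex ξ (m + 1))⁻¹)
      (v := (rayVertex ξ (m + 1))⁻¹ * g) (by
        rw [hhead, FreeGroup.toWord_inv, toWord_rayVertex, List.range_succ, List.map_append]
        intro a ha hb
        simp only [FreeGroup.invRev, List.map_append, List.map_cons, List.map_nil,
          List.reverse_append, List.reverse_cons, List.reverse_nil, List.nil_append,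
          List.cons_append, List.head?_cons, Option.mem_def, Option.some_inj] at ha hb
        exact ξ.2 m (hb.trans ha.symm))
    rw [inv_inv, mul_inv_cancel_left, FreeGroup.norm_inv_eq, norm_rayVertex] at this
    omega

/-- Axes that share one end share the other end as well. -/
theorem IsAxisEnd.inv_unique [Finite α] (hξ : IsAxisEnd g w ξ) (hη : IsAxisEnd g w⁻¹ η)
    (hξ' : IsAxisEnd h v ξ) (hζ : IsAxisEnd h v⁻¹ ζ) : η = ζ := by
  -- Both axes follow the ray to `ξ`; the offset `g.norm + h.norm + 1` starts beyond both base
  -- vertices.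
  have near : ∀ n : ℕ, ∃ p : ℕ × ℕ,
      ((rayVertex ξ (g.norm + h.norm + 1 + n))⁻¹ * (g * w ^ p.1)).norm ≤ w.norm ∧
      ((rayVertex ξ (g.norm + h.norm + 1 + n))⁻¹ * (h * v ^ p.2)).norm ≤ v.norm := by
    intro n
    obtain ⟨i, hi⟩ := hξ.exists_near_rayVertex (n := g.norm + h.norm + 1 + n) (by omega)
    obtain ⟨j, hj⟩ := hξ'.exists_near_rayVertex (n := g.norm + h.norm + 1 + n) (by omega)
    exact ⟨(i, j), hi, hj⟩
  choose p hp hp' using near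
  have grow : ∀ {k x : FreeGroup α} {n i : ℕ}, ((rayVertex ξ n)⁻¹ * (k * x ^ i)).norm ≤ x.norm →
      n ≤ k.norm + i * x.norm + x.norm := by
    intro k x n i hle
    have h1 := FreeGroup.norm_mul_le (k * x ^ i) ((rayVertex ξ n)⁻¹ * (k * x ^ i))⁻¹
    rw [show k * x ^ i * ((rayVertex ξ n)⁻¹ * (k * x ^ i))⁻¹ = rayVertex ξ n by group,
      norm_rayVertex, FreeGroup.norm_inv_eq] at h1
    have h2 := FreeGroup.norm_mul_le k (x ^ i)
    have h3 := FreeGroup.norm_pow_le x i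
    omega
  have hball : ∀ n, ((g * w ^ (p n).1)⁻¹ * (h * v ^ (p n).2)).norm ≤ w.norm + v.norm := by
    intro n
    have h1 := FreeGroup.norm_mul_le
      ((rayVertex ξ (g.norm + h.norm + 1 + n))⁻¹ * (g * w ^ (p n).1))⁻¹
      ((rayVertex ξ (g.norm + h.norm + 1 + n))⁻¹ * (h * v ^ (p n).2))
    rw [FreeGroup.norm_inv_eq] at h1
    rw [show ((rayVertex ξ (g.norm + h.norm + 1 + n))⁻¹ * (g * w ^ (p n).1))⁻¹ *
      ((rayVertex ξ (g.norm + h.norm + 1 + n))⁻¹ * (h * v ^ (p n).2)) =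
      (g * w ^ (p n).1)⁻¹ * (h * v ^ (p n).2) by group] at h1
    exact h1.trans (add_le_add (hp n) (hp' n))
  have : Finite {c : FreeGroup α | c.norm ≤ w.norm + v.norm} :=
    (FreeGroup.finite_norm_le _).to_subtype
  -- Differences between nearby vertices of the two axes lie in a finite ball, so one value `c`
  -- recurs; `m` is then taken so large that `grow` makes both exponents increase.
  obtain ⟨⟨c, hc⟩, hinf⟩ := Finite.exists_infinite_fiber
    (fun n => (⟨_, hball n⟩ : {c : FreeGroup α | c.norm ≤ w.norm + v.norm}))
  rw [Set.infinite_coe_iff] at hinf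
  obtain ⟨n, hn⟩ := hinf.nonempty
  obtain ⟨m, hm, hlt⟩ := hinf.exists_gt (g.norm + (p n).1 * w.norm + w.norm +
    (h.norm + (p n).2 * v.norm + v.norm))
  simp only [Set.mem_preimage, Set.mem_singleton_iff, Subtype.mk.injEq] at hn hm
  have hi : (p n).1 < (p m).1 := by
    by_contra hle
    have h1 := grow (hp m)
    have h2 := Nat.mul_le_mul_right w.norm (not_lt.1 hle)
    omega
  have hj : (p n).2 < (p m).2 := by
    by_contra hle
    have h1 := grow (hp' m)
    have h2 := Nat.mul_le_mul_right v.norm (not_lt.1 hle)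
    omega
  obtain ⟨a, ha⟩ := Nat.exists_eq_add_of_lt hi
  obtain ⟨b, hb⟩ := Nat.exists_eq_add_of_lt hj
  rw [inv_mul_eq_iff_eq_mul] at hn hm
  -- The repeated difference makes positive powers of `v` and `w` conjugate, so the backward
  -- sequences also stay at bounded distance.
  have hconj : SemiconjBy (g⁻¹ * h) (v ^ (b + 1)) (w ^ (a + 1)) := by
    have h1 : g⁻¹ * h * v ^ (p n).2 = w ^ (p n).1 * c := by
      rw [mul_assoc, hn]; group
    have h2 : g⁻¹ * h * v ^ (p m).2 = w ^ (p m).1 * c := by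
      rw [mul_assoc, hm]; group
    refine mul_right_cancel (b := v ^ (p n).2) ?_
    rw [mul_assoc _ (v ^ _), ← pow_add, mul_assoc (w ^ _), h1, ← mul_assoc, ← pow_add,
      show b + 1 + (p n).2 = (p m).2 by omega, show a + 1 + (p n).1 = (p m).1 by omega, h2]
  have sub : ∀ a : ℕ, Tendsto (fun k : ℕ => (a + 1) * k) atTop atTop := fun a =>
    tendsto_atTop_mono (fun k => Nat.le_mul_of_pos_left k a.succ_pos) tendsto_id
  refine (VertexLimit.comp hη (sub a)).eq_of_mul_right (c := g⁻¹ * h) ?_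
  have hlim := VertexLimit.comp hζ (sub b)
  have heq : ∀ k : ℕ, g * w⁻¹ ^ ((a + 1) * k) * (g⁻¹ * h) = h * v⁻¹ ^ ((b + 1) * k) := by
    intro k
    have h1 := (hconj.inv_right.pow_right k).eq
    rw [← inv_pow, ← inv_pow, ← pow_mul, ← pow_mul] at h1
    rw [mul_assoc g, ← h1]
    group
  simpa only [heq] using hlim

end FreeBoundary

/-! ### Lines of the pattern. -/

section Lines
variable {α : Type*} [DecidableEq α] {W : Finset (FreeGroup α)} {ξ η ζ : FreeBoundary α}

/-- The symmetric relation of being the two ends of a line. -/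
def LineRel (W : Finset (FreeGroup α)) (ξ η : FreeBoundary α) : Prop :=
  LineEnds W ξ η ∨ LineEnds W η ξ

theorem LineRel.symm (h : LineRel W ξ η) : LineRel W η ξ := Or.symm h

theorem LineRel.smul (g : FreeGroup α) (h : LineRel W ξ η) : LineRel W (g • ξ) (g • η) :=
  h.imp (LineEnds.smul g) (LineEnds.smul g)

theorem LineRel.exists_axis (h : LineRel W ξ η) :
    ∃ w g, FreeBoundary.IsAxisEnd g w ξ ∧ FreeBoundary.IsAxisEnd g w⁻¹ η := by
  rcases h with ⟨w, -, g, h1, h2⟩ | ⟨w, -, g, h1, h2⟩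
  · exact ⟨w, g, h1, h2⟩
  · exact ⟨w⁻¹, g, h2, by rwa [inv_inv]⟩

theorem LineRel.unique [Finite α] (h : LineRel W ξ η) (h' : LineRel W ξ ζ) : η = ζ := by
  obtain ⟨w, g, h1, h2⟩ := h.exists_axis
  obtain ⟨v, k, h3, h4⟩ := h'.exists_axis
  exact h1.inv_unique h2 h3 h4

/-- Only finitely many lines pass through the identity vertex. -/
theorem finite_lineEnds_head_ne [Finite α] (W : Finset (FreeGroup α)) :
    {p : FreeBoundary α × FreeBoundary α | LineEnds W p.1 p.2 ∧ p.1.1 0 ≠ p.2.1 0}.Finite := by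
  refine (W.finite_toSet.biUnion fun w _ => (FreeGroup.finite_norm_le w.norm).biUnion fun g _ =>
    Set.Subsingleton.finite (s := {p : FreeBoundary α × FreeBoundary α |
      FreeBoundary.IsAxisEnd g w p.1 ∧ FreeBoundary.IsAxisEnd g w⁻¹ p.2}) ?_).subset ?_
  · rintro ⟨a, b⟩ ⟨h1, h2⟩ ⟨a', b'⟩ ⟨h3, h4⟩
    exact Prod.ext (h1.unique h3) (h2.unique h4)
  · rintro ⟨ξ, η⟩ ⟨⟨w, hw, g, h1, h2⟩, hne⟩
    simp only [Set.mem_iUnion]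
    -- If neither half of the line came within `w.norm` of the identity, both ends would share the
    -- first letter of `g`. So the line can be based at a vertex in that ball.
    rcases h1.near_or_head with ⟨i, hi⟩ | hξ
    · exact ⟨w, hw, g * w ^ i, hi, h1.shift i, h2.shift_inv i⟩
    rcases h2.near_or_head with ⟨i, hi⟩ | hη
    · refine ⟨w, hw, g * w⁻¹ ^ i, by rwa [FreeGroup.norm_inv_eq] at hi, ?_, h2.shift i⟩
      have := FreeBoundary.IsAxisEnd.shift_inv (w := w⁻¹) (ξ := ξ) (g := g)
        (by rwa [inv_inv]) i
      rwa [inv_inv] at this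
    · rw [hξ, Option.some_inj] at hη
      exact absurd hη hne

end Lines

/-! ### Invariance under homeomorphisms. -/

section Homeomorph
variable {X : Type*} [TopologicalSpace X] (h : X ≃ₜ X)

theorem IsCutSet.image {S : Set X} (hS : IsCutSet S) : IsCutSet (h '' S) := by
  rwa [IsCutSet, ← Set.image_compl_eq h.bijective, h.isPreconnected_image]

theorem IsCutPoint.image {x : X} (hx : IsCutPoint x) : IsCutPoint (h x) := by
  have := IsCutSet.image h hx
  rwa [Set.image_singleton] at this

theorem IsCutPair.image {S : Set X} (hS : IsCutPair S) : IsCutPair (h '' S) := by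
  obtain ⟨hc, x, y, hxy, rfl, hx, hy⟩ := hS
  refine ⟨hc.image h, h x, h y, h.injective.ne hxy, Set.image_pair _ _ _, ?_, ?_⟩
  · intro hcx
    have := hcx.image h.symm
    rw [h.symm_apply_apply] at this
    exact hx this
  · intro hcy
    have := hcy.image h.symm
    rw [h.symm_apply_apply] at this
    exact hy this

theorem Crosses.image {S T : Set X} (hST : Crosses S T) : Crosses (h '' S) (h '' T) := by
  obtain ⟨x, y, rfl, hx, hy, hxy⟩ := hST
  refine ⟨h x, h y, Set.image_pair _ _ _, ?_, ?_, ?_⟩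
  · simpa [h.injective.mem_set_image] using hx
  · simpa [h.injective.mem_set_image] using hy
  · rwa [← Set.image_compl_eq h.bijective, ← h.image_connectedComponentIn hx,
      h.injective.mem_set_image]

theorem IsUncrossedCutPair.image {S : Set X} (hS : IsUncrossedCutPair S) :
    IsUncrossedCutPair (h '' S) := by
  refine ⟨hS.1.image h, fun T hT hTS => hS.2 _ (hT.image h.symm) ?_⟩
  have := hTS.image h.symm
  rwa [← Set.image_comp, show ⇑h.symm ∘ ⇑h = id from funext h.symm_apply_apply,
    Set.image_id] at this

end Homeomorph

/-! ### Walls in the decomposition space and compatible clopen sets. -/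

namespace DecompositionSpace
variable {α : Type*} [DecidableEq α] {W : Finset (FreeGroup α)} {ξ η ζ : FreeBoundary α}

/-- The quotient map from the boundary of the tree. -/
def mk (W : Finset (FreeGroup α)) : FreeBoundary α → DecompositionSpace W := Quot.mk (LineEnds W)

theorem mk_surjective : Function.Surjective (mk W) := Quot.mk_surjective

theorem isQuotientMap_mk : Topology.IsQuotientMap (mk W) := isQuotientMap_quot_mk

theorem smul_mk (g : FreeGroup α) (ξ : FreeBoundary α) : g • mk W ξ = mk W (g • ξ) := rfl

theorem mk_eq_of_lineRel (h : LineRel W ξ η) : mk W ξ = mk W η :=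
  h.elim (fun h => Quot.sound h) fun h => (Quot.sound h).symm

/-- A ray determines the other end of any line ending at it (`LineRel.unique`), so transitivity
generates no new identifications. -/
theorem mk_eq_iff [Finite α] : mk W ξ = mk W η ↔ η = ξ ∨ LineRel W ξ η := by
  refine ⟨fun h => ?_, ?_⟩
  · induction Quot.eqvGen_exact h with
    | rel a b hab => exact Or.inr (Or.inl hab)
    | refl a => exact Or.inl rfl
    | symm a b hab ih => exact (ih (Quot.eqvGen_sound hab)).imp Eq.symm LineRel.symm
    | trans a b c hab hbc ih1 ih2 =>
      rcases ih1 (Quot.eqvGen_sound hab) with rfl | h1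
      · exact ih2 (Quot.eqvGen_sound hbc)
      rcases ih2 (Quot.eqvGen_sound hbc) with rfl | h2
      · exact Or.inr h1
      · exact Or.inl (h2.unique h1.symm)
  · rintro (rfl | h)
    · rfl
    · exact mk_eq_of_lineRel h

theorem finite_fiber [Finite α] (ξ : FreeBoundary α) : {η | mk W ξ = mk W η}.Finite := by
  have : {η | LineRel W ξ η}.Subsingleton := fun a ha b hb => ha.unique hb
  exact ((Set.finite_singleton ξ).union this.finite).subset fun η h => mk_eq_iff.1 h

instance [Finite α] : T1Space (DecompositionSpace W) where
  t1 x := by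
    obtain ⟨ξ, rfl⟩ := mk_surjective x
    rw [← isQuotientMap_mk.isClosed_preimage]
    exact ((finite_fiber (W := W) ξ).subset fun η hη => Eq.symm hη).isClosed

instance : ContinuousConstSMul (FreeGroup α) (DecompositionSpace W) where
  continuous_const_smul g :=
    isQuotientMap_mk.continuous_iff.2 (isQuotientMap_mk.continuous.comp (continuous_const_smul g))

theorem isUncrossedCutPair_smul (g : FreeGroup α) {S : Set (DecompositionSpace W)}
    (hS : IsUncrossedCutPair S) : IsUncrossedCutPair (g • S) :=
  hS.image (Homeomorph.smul g)

/-- The points of the decomposition space all of whose representatives start with `s`. -/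
def inside (W : Finset (FreeGroup α)) (s : α × Bool) : Set (DecompositionSpace W) :=
  {x | ∀ ξ, mk W ξ = x → ξ.1 0 = s}

/-- The points of the decomposition space none of whose representatives starts with `s`. -/
def outside (W : Finset (FreeGroup α)) (s : α × Bool) : Set (DecompositionSpace W) :=
  {x | ∀ ξ, mk W ξ = x → ξ.1 0 ≠ s}

/-- The lines through the identity vertex, as points of the decomposition space. -/
def crossing (W : Finset (FreeGroup α)) : Set (DecompositionSpace W) :=
  (fun p => mk W p.1) '' {p : FreeBoundary α × FreeBoundary α | LineEnds W p.1 p.2 ∧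
    p.1.1 0 ≠ p.2.1 0}

theorem finite_crossing [Finite α] (W : Finset (FreeGroup α)) : (crossing W).Finite :=
  (finite_lineEnds_head_ne W).image _

theorem mk_mem_crossing (h : LineRel W ξ η) (hne : ξ.1 0 ≠ η.1 0) : mk W ξ ∈ crossing W := by
  rcases h with h | h
  · exact ⟨(ξ, η), ⟨h, hne⟩, rfl⟩
  · exact ⟨(η, ξ), ⟨h, hne.symm⟩, mk_eq_of_lineRel (Or.inl h)⟩

theorem finite_wall [Finite α] (W : Finset (FreeGroup α)) (s : α × Bool) :
    (inside W s ∪ outside W s)ᶜ.Finite := by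
  refine (finite_crossing W).subset fun x hx => ?_
  simp only [inside, outside, Set.mem_compl_iff, Set.mem_union, Set.mem_ofPred_eq, not_or,
    not_forall, not_not] at hx
  obtain ⟨⟨ξ, rfl, hξ⟩, η, hη, rfl⟩ := hx
  rcases mk_eq_iff.1 hη with rfl | h
  · exact absurd rfl hξ
  · exact mk_eq_of_lineRel h ▸ mk_mem_crossing h fun h => hξ h.symm

/-- Each side together with the wall pulls back to a clopen set of rays enlarged by the preimage of
a finite set. -/
theorem isWall [Finite α] (W : Finset (FreeGroup α)) (s : α × Bool) :
    IsWall (inside W s) (inside W s ∪ outside W s)ᶜ (outside W s) := by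
  have hd : Disjoint (inside W s) (outside W s) := by
    refine Set.disjoint_left.2 fun x h1 h2 => ?_
    obtain ⟨ξ, rfl⟩ := mk_surjective x
    exact h2 ξ rfl (h1 ξ rfl)
  have hE := (finite_wall W s).isClosed
  refine ⟨?_, ?_, hd, ?_, ?_, ?_⟩
  · exact Set.disjoint_left.2 fun x h1 h2 => h2 (Or.inl h1)
  · exact Set.disjoint_left.2 fun x h1 h2 => h1 (Or.inr h2)
  · ext x
    simp only [Set.mem_union, Set.mem_compl_iff, Set.mem_univ, iff_true]
    tauto
  · rw [← isQuotientMap_mk.isClosed_preimage]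
    have : mk W ⁻¹' (inside W s ∪ (inside W s ∪ outside W s)ᶜ) =
        {ξ | ξ.1 0 ∈ ({s} : Set _)} ∪ mk W ⁻¹' (inside W s ∪ outside W s)ᶜ := by
      ext ξ
      have h1 : mk W ξ ∈ inside W s → ξ.1 0 = s := fun h => h ξ rfl
      have h2 : mk W ξ ∈ outside W s → ξ.1 0 ≠ s := fun h => h ξ rfl
      simp only [Set.mem_preimage, Set.mem_union, Set.mem_compl_iff, Set.mem_ofPred_eq,
        Set.mem_singleton_iff]
      tauto
    rw [this]
    exact (FreeBoundary.isClopen_coord 0 {s}).isClosed.union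
      (hE.preimage isQuotientMap_mk.continuous)
  · rw [← isQuotientMap_mk.isClosed_preimage]
    have : mk W ⁻¹' (outside W s ∪ (inside W s ∪ outside W s)ᶜ) =
        {ξ | ξ.1 0 ∈ ({s} : Set _)ᶜ} ∪ mk W ⁻¹' (inside W s ∪ outside W s)ᶜ := by
      ext ξ
      have h1 : mk W ξ ∈ inside W s → ξ.1 0 = s := fun h => h ξ rfl
      have h2 : mk W ξ ∈ outside W s → ξ.1 0 ≠ s := fun h => h ξ rfl
      simp only [Set.mem_preimage, Set.mem_union, Set.mem_compl_iff, Set.mem_ofPred_eq,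
        Set.mem_singleton_iff]
      tauto
    rw [this]
    exact (FreeBoundary.isClopen_coord 0 {s}ᶜ).isClosed.union
      (hE.preimage isQuotientMap_mk.continuous)

/-- In a connected decomposition space, a clopen set of rays that is compatible with the line
pattern is trivial. -/
theorem eq_empty_of_isClopen [ConnectedSpace (DecompositionSpace W)]
    {U : Set (FreeBoundary α)} (hU : IsClopen U)
    (hsat : ∀ ξ η, LineEnds W ξ η → (ξ ∈ U ↔ η ∈ U)) (hξ : ξ ∉ U) : U = ∅ := by
  let V : Set (DecompositionSpace W) := {x | Quot.lift (· ∈ U) (fun a b h => propext (hsat a b h)) x}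
  have hV : IsClopen V := by
    have hpre : mk W ⁻¹' V = U := rfl
    exact ⟨isQuotientMap_mk.isClosed_preimage.1 (hpre ▸ hU.1),
      isQuotientMap_mk.isOpen_preimage.1 (hpre ▸ hU.2)⟩
  have hVe : V = ∅ := (isClopen_iff.1 hV).resolve_right fun h =>
    hξ (show mk W ξ ∈ V from h ▸ Set.mem_univ _)
  exact Set.eq_empty_of_forall_notMem fun η hη =>
    Set.notMem_empty (mk W η) (hVe ▸ (show mk W η ∈ V from hη))

/-- The clopen sets of rays starting with `s` that are compatible with the lines staying in that
branch of the tree. -/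
def compatibleClopens (W : Finset (FreeGroup α)) (s : α × Bool) : Set (Set (FreeBoundary α)) :=
  {U | IsClopen U ∧ (∀ ξ ∈ U, ξ.1 0 = s) ∧
    ∀ ξ η, LineEnds W ξ η → ξ.1 0 = s → η.1 0 = s → (ξ ∈ U ↔ η ∈ U)}

/-- Such a set is determined by its trace on `Q`, the ends of lines through the identity. If `U` and
`V` have equal traces, `U \ V` respects all lines: those within one branch by compatibility, the
others through `Q`. Connectedness then makes it empty. -/
theorem finite_compatibleClopens [Finite α] [ConnectedSpace (DecompositionSpace W)]
    (s : α × Bool) : (compatibleClopens W s).Finite := by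
  set T : Set (FreeBoundary α × FreeBoundary α) :=
    {p | LineEnds W p.1 p.2 ∧ p.1.1 0 ≠ p.2.1 0} with hT
  set Q : Set (FreeBoundary α) := Prod.fst '' T ∪ Prod.snd '' T with hQ
  have hQf : Q.Finite :=
    ((finite_lineEnds_head_ne W).image _).union ((finite_lineEnds_head_ne W).image _)
  refine Set.Finite.of_finite_image (f := fun U => U ∩ Q)
    (hQf.finite_subsets.subset (Set.image_subset_iff.2 fun U _ => Set.inter_subset_right)) ?_
  have key : ∀ U ∈ compatibleClopens W s, ∀ V ∈ compatibleClopens W s, U ∩ Q = V ∩ Q →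
      U ⊆ V := by
    rintro U ⟨hU, hUs, hUc⟩ V ⟨hV, hVs, hVc⟩ hUV
    have hQ' : ∀ ξ ∈ Q, (ξ ∈ U ↔ ξ ∈ V) := fun ξ hξ => by
      have := Set.ext_iff.1 hUV ξ
      simpa [hξ] using this
    rw [← Set.sdiff_eq_empty]
    refine eq_empty_of_isClopen (W := W) (hU.diff hV) ?_
      -- A ray outside the branch of `s`, which rules out the whole boundary.
      (ξ := ⟨fun _ => letterInv s, fun _ => (letterInv_ne _).symm⟩)
      fun h => letterInv_ne s (hUs _ h.1)
    intro ξ η h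
    by_cases hne : ξ.1 0 = η.1 0
    · have h1 := hUs ξ
      have h2 := hUs η
      have h3 := hUc ξ η h
      have h4 := hVc ξ η h
      simp only [Set.mem_sdiff]
      grind
    · have h1 := hQ' ξ (Or.inl ⟨(ξ, η), ⟨h, hne⟩, rfl⟩)
      have h2 := hQ' η (Or.inr ⟨(ξ, η), ⟨h, hne⟩, rfl⟩)
      simp only [Set.mem_sdiff, h1, h2]
      tauto
  exact fun U hU V hV h => (key U hU V hV h).antisymm (key V hV U hU h.symm)

/-- Independence of `s` and `U` lets one depth serve at all vertices along a ray. -/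
theorem exists_uniform_depth [Finite α] (W : Finset (FreeGroup α))
    [ConnectedSpace (DecompositionSpace W)] :
    ∃ d, ∀ s, ∀ U ∈ compatibleClopens W s, ∀ ξ η : FreeBoundary α, (∀ k < d, η.1 k = ξ.1 k) →
      (ξ ∈ U ↔ η ∈ U) := by
  have hfin : (⋃ s, compatibleClopens W s).Finite := Set.finite_iUnion finite_compatibleClopens
  have hdepth : ∀ U : (⋃ s, compatibleClopens W s), ∃ d, ∀ ξ η : FreeBoundary α,
      (∀ k < d, η.1 k = ξ.1 k) → (ξ ∈ (U : Set _) ↔ η ∈ (U : Set _)) := by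
    rintro ⟨U, hU⟩
    obtain ⟨s, hs⟩ := Set.mem_iUnion.1 hU
    exact FreeBoundary.exists_depth hs.1
  choose d hd using hdepth
  have := hfin.to_subtype
  obtain ⟨D, hD⟩ := (Set.finite_range d).bddAbove
  refine ⟨D, fun s U hU ξ η h => ?_⟩
  exact hd ⟨U, Set.mem_iUnion.2 ⟨s, hU⟩⟩ ξ η fun k hk => h k (hk.trans_le (hD ⟨_, rfl⟩))

end DecompositionSpace

/-! ### Looking back along a ray. -/

namespace FreeBoundary
variable {α : Type*} [DecidableEq α] {ξ η η' : FreeBoundary α}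

/-- The rays that leave the ray of `ξ` at one of its first `n + 1` vertices: seen from the next
vertex, they start by going back along `ξ`. -/
def leaveBefore (ξ : FreeBoundary α) (n : ℕ) : Set (FreeBoundary α) :=
  {η | ((rayVertex ξ (n + 1))⁻¹ • η).1 0 = letterInv (ξ.1 n)}

theorem rayVertex_inv_smul_self (ξ : FreeBoundary α) (n : ℕ) :
    ((rayVertex ξ n)⁻¹ • ξ).1 0 = ξ.1 n :=
  rayVertex_inv_smul_apply (fun _ _ => rfl) 0

theorem head_ne_of_mem_leaveBefore {n : ℕ} (h : η ∈ leaveBefore ξ n) :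
    ((rayVertex ξ (n + 1))⁻¹ • η).1 0 ≠ ξ.1 (n + 1) := by
  rw [show _ = _ from h]
  exact (ξ.2 n).symm

theorem leaveBefore_mono (ξ : FreeBoundary α) : Monotone (leaveBefore ξ) := by
  refine monotone_nat_of_le_succ fun n η hη => ?_
  change (_ : FreeBoundary α).1 0 = _
  rw [rayVertex_succ_inv_smul,
    letterMul_letterInv_apply_zero (head_ne_of_mem_leaveBefore hη)]

theorem exists_mem_leaveBefore (hne : η ≠ ξ) : ∃ n, η ∈ leaveBefore ξ n := by
  have hex : ∃ n, η.1 n ≠ ξ.1 n := by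
    by_contra hcon
    push Not at hcon
    exact hne (Subtype.ext (funext hcon))
  have hlt : ∀ k < Nat.find hex, η.1 k = ξ.1 k := fun k hk => by
    have := Nat.find_min hex hk
    push Not at this
    exact this
  refine ⟨Nat.find hex, ?_⟩
  change (_ : FreeBoundary α).1 0 = _
  rw [rayVertex_succ_inv_smul, letterMul_letterInv_apply_zero]
  rw [rayVertex_inv_smul_apply hlt]
  exact Nat.find_spec hex

/-- Seen from far along `ξ`, rays that leave `ξ` early are close to each other. -/
theorem agree_of_mem_leaveBefore {n : ℕ} (h : η ∈ leaveBefore ξ n) (h' : η' ∈ leaveBefore ξ n)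
    (m : ℕ) : ∀ k < m, ((rayVertex ξ (n + m + 1))⁻¹ • η).1 k =
      ((rayVertex ξ (n + m + 1))⁻¹ • η').1 k := by
  induction m with
  | zero => intro k hk; omega
  | succ m ih =>
    intro k hk
    have h1 := head_ne_of_mem_leaveBefore (leaveBefore_mono ξ (Nat.le_add_right n m) h)
    have h2 := head_ne_of_mem_leaveBefore (leaveBefore_mono ξ (Nat.le_add_right n m) h')
    rw [← Nat.add_assoc, rayVertex_succ_inv_smul ξ η, rayVertex_succ_inv_smul ξ η']
    cases k with
    | zero => rw [letterMul_letterInv_apply_zero h1, letterMul_letterInv_apply_zero h2]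
    | succ k =>
      rw [letterMul_letterInv_apply_succ h1, letterMul_letterInv_apply_succ h2]
      exact ih k (by omega)

end FreeBoundary

/-! ### Cut points are lines; separating two points by an edge. -/

namespace DecompositionSpace
open FreeBoundary
variable {α : Type*} [DecidableEq α] {W : Finset (FreeGroup α)} {ξ η ξ' η' : FreeBoundary α}
  {x y : DecompositionSpace W}

/-- A point with only one representative is not a cut point. -/
theorem not_isCutPoint_of_fiber [Finite α] [ConnectedSpace (DecompositionSpace W)]
    (hξ : ∀ η, mk W η = mk W ξ → η = ξ) : ¬ IsCutPoint (mk W ξ) := by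
  intro hcut
  obtain ⟨A, B, h⟩ := hcut.exists_partition isClosed_singleton
  obtain ⟨d, hd⟩ := exists_uniform_depth W
  have hne : ∀ {η}, mk W η ∈ A ∪ B → η ≠ ξ := by
    rintro η hη rfl
    rw [h.union] at hη
    exact hη rfl
  obtain ⟨a, ha⟩ := h.nonempty_left
  obtain ⟨b, hb⟩ := h.nonempty_right
  obtain ⟨a, rfl⟩ := mk_surjective a
  obtain ⟨b, rfl⟩ := mk_surjective b
  obtain ⟨i, hi⟩ := exists_mem_leaveBefore (hne (Or.inl ha))
  obtain ⟨j, hj⟩ := exists_mem_leaveBefore (hne (Or.inr hb))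
  replace hi := leaveBefore_mono ξ (le_max_left i j) hi
  replace hj := leaveBefore_mono ξ (le_max_right i j) hj
  -- Both rays have left `ξ` by stage `max i j`; `d` further steps give them `d` common letters of
  -- backtracking.
  set n := max i j + d
  set p := rayVertex ξ (n + 1) with hp
  have hU : {ζ : FreeBoundary α | ζ.1 0 = letterInv (ξ.1 n) ∧ mk W (p • ζ) ∈ A} ∈
      compatibleClopens W (letterInv (ξ.1 n)) := by
    have hcont : Continuous fun ζ : FreeBoundary α => mk W (p • ζ) :=
      isQuotientMap_mk.continuous.comp (continuous_const_smul p)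
    have hC := isClopen_coord (α := α) 0 {letterInv (ξ.1 n)}
    refine ⟨⟨?_, hC.isOpen.inter (h.isOpen_left.preimage hcont)⟩, fun ζ hζ => hζ.1, ?_⟩
    -- The ray `ξ` points forward, so the backward branch avoids the removed point; this is where
    -- its having one representative matters.
    · have : {ζ : FreeBoundary α | ζ.1 0 = letterInv (ξ.1 n) ∧ mk W (p • ζ) ∈ A} =
          {ζ | ζ.1 0 ∈ ({letterInv (ξ.1 n)} : Set _)} ∩
            (fun ζ => mk W (p • ζ)) ⁻¹' (A ∪ {mk W ξ}) := by
        ext ζ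
        simp only [Set.mem_ofPred_eq, Set.mem_inter_iff, Set.mem_preimage, Set.mem_union,
          Set.mem_singleton_iff]
        refine and_congr_right fun h0 => ⟨Or.inl, fun h1 => h1.resolve_right fun h2 => ?_⟩
        have h3 : ζ = p⁻¹ • ξ := eq_inv_smul_iff.2 (hξ _ h2)
        rw [h3, hp, rayVertex_inv_smul_self] at h0
        exact ξ.2 n h0
      rw [this]
      exact hC.isClosed.inter (h.closed_left.preimage hcont)
    · intro ζ ζ' hl h0 h0'
      simp only [Set.mem_ofPred_eq, h0, h0', true_and]
      rw [mk_eq_of_lineRel (Or.inl (hl.smul p))]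
  have hab := hd _ _ hU (p⁻¹ • a) (p⁻¹ • b) (agree_of_mem_leaveBefore hj hi d)
  simp only [Set.mem_ofPred_eq, smul_inv_smul, ha, and_true] at hab
  have hB := hab.1 (leaveBefore_mono ξ (Nat.le_add_right _ d) hi)
  exact Set.disjoint_left.1 h.disjoint hB.2 hb

/-- A point with one representative is separated from every other point by an edge of the tree. -/
theorem exists_separating_edge_of_fiber [Finite α] (hξ : ∀ η, mk W η = mk W ξ → η = ξ)
    (hy : y ≠ mk W ξ) :
    ∃ (g : FreeGroup α) (s : α × Bool), g • y ∈ inside W s ∧ g • mk W ξ ∈ outside W s := by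
  -- Finiteness of the fibre gives one stage by which all representatives of `y` have left `ξ`.
  have hfib : ∃ n, ∀ ζ, mk W ζ = y → ζ ∈ leaveBefore ξ n := by
    obtain ⟨η, rfl⟩ := mk_surjective y
    have hc : ∀ ζ : {ζ | mk W η = mk W ζ}, ∃ n, ζ.1 ∈ leaveBefore ξ n := fun ζ =>
      exists_mem_leaveBefore fun h => hy (by rw [← h]; exact ζ.2)
    choose f hf using hc
    have := (finite_fiber (W := W) η).to_subtype
    obtain ⟨N, hN⟩ := (Set.finite_range f).bddAbove
    exact ⟨N, fun ζ hζ => leaveBefore_mono ξ (hN ⟨⟨ζ, hζ.symm⟩, rfl⟩) (hf ⟨ζ, hζ.symm⟩)⟩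
  obtain ⟨n, hn⟩ := hfib
  refine ⟨(rayVertex ξ (n + 1))⁻¹, letterInv (ξ.1 n), ?_, ?_⟩
  · intro ζ hζ
    have := hn (rayVertex ξ (n + 1) • ζ) (by rw [← smul_mk, hζ, smul_inv_smul])
    simpa [leaveBefore] using this
  · intro ζ hζ
    have := hξ (rayVertex ξ (n + 1) • ζ) (by rw [← smul_mk, hζ, smul_inv_smul])
    rw [eq_inv_smul_iff.2 this, rayVertex_inv_smul_self]
    exact ξ.2 n

/-- Of two lines, the first of which passes through the identity, either the second is separated
from the first by an edge or both pass through a common vertex. -/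
theorem exists_edge_or_vertex (N : ℕ) : ∀ {ξ ξ' η η' : FreeBoundary α}, ξ.1 0 ≠ ξ'.1 0 →
    (∀ k < N, η.1 k = η'.1 k) → η.1 N ≠ η'.1 N → ∃ g : FreeGroup α,
      (∃ s, (g • η).1 0 = s ∧ (g • η').1 0 = s ∧ (g • ξ).1 0 ≠ s ∧ (g • ξ').1 0 ≠ s) ∨
      ((g • ξ).1 0 ≠ (g • ξ').1 0 ∧ (g • η).1 0 ≠ (g • η').1 0) := by
  -- The induction walks along the common initial segment of `η` and `η'`.
  induction N with
  | zero => exact fun hξ _ hη => ⟨1, Or.inr (by simpa using ⟨hξ, hη⟩)⟩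
  | succ N ih =>
    intro ξ ξ' η η' hξ hlt hη
    have h0 : η'.1 0 = η.1 0 := (hlt 0 N.succ_pos).symm
    by_cases hs : ξ.1 0 ≠ η.1 0 ∧ ξ'.1 0 ≠ η.1 0
    · exact ⟨1, Or.inl ⟨η.1 0, by simp, by simp [h0], by simpa using hs.1, by simpa using hs.2⟩⟩
    -- Exactly one of `ξ`, `ξ'` starts along the edge `η.1 0`, so their line also passes through the
    -- next vertex.
    have hhead : (letterMul (letterInv (η.1 0)) ξ).1 0 ≠
        (letterMul (letterInv (η.1 0)) ξ').1 0 := by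
      by_cases h1 : ξ.1 0 = η.1 0
      · have h2 : ξ'.1 0 ≠ η.1 0 := fun h => hξ (h1.trans h.symm)
        rw [letterMul_letterInv_self_apply h1, letterMul_letterInv_apply_zero h2, ← h1]
        exact ξ.2 0
      · have h2 : ξ'.1 0 = η.1 0 := by
          by_contra h2
          exact hs ⟨h1, h2⟩
        rw [letterMul_letterInv_self_apply h2, letterMul_letterInv_apply_zero h1, ← h2]
        exact (ξ'.2 0).symm
    obtain ⟨g, hg⟩ := ih hhead (η := letterMul (letterInv (η.1 0)) η)
      (η' := letterMul (letterInv (η.1 0)) η')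
      (fun k hk => by
        rw [letterMul_letterInv_self_apply rfl, letterMul_letterInv_self_apply h0]
        exact hlt (k + 1) (by omega))
      (by rwa [letterMul_letterInv_self_apply rfl, letterMul_letterInv_self_apply h0])
    refine ⟨g * (FreeGroup.mk [η.1 0])⁻¹, ?_⟩
    simpa only [mul_smul, mk_singleton_inv_smul] using hg

theorem mem_inside_of_lineRel [Finite α] (h : LineRel W ξ ξ') {s : α × Bool} (h1 : ξ.1 0 = s)
    (h2 : ξ'.1 0 = s) : mk W ξ ∈ inside W s := by
  intro ζ hζ
  rcases mk_eq_iff.1 hζ.symm with rfl | h'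
  · exact h1
  · rwa [h'.unique h]

theorem mem_outside_of_lineRel [Finite α] (h : LineRel W ξ ξ') {s : α × Bool} (h1 : ξ.1 0 ≠ s)
    (h2 : ξ'.1 0 ≠ s) : mk W ξ ∈ outside W s := by
  intro ζ hζ
  rcases mk_eq_iff.1 hζ.symm with rfl | h'
  · exact h1
  · rwa [h'.unique h]

theorem exists_lineRel_of_fiber [Finite α] (h : ¬ ∀ η, mk W η = mk W ξ → η = ξ) :
    ∃ η, LineRel W ξ η ∧ ξ ≠ η := by
  push Not at h
  obtain ⟨η, h1, h2⟩ := h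
  exact ⟨η, (mk_eq_iff.1 h1.symm).resolve_left h2, h2.symm⟩

/-- Two points are separated by an edge of the tree, or are lines through a common vertex. -/
theorem exists_separating_edge_or_vertex [Finite α] (hxy : x ≠ y) :
    ∃ g : FreeGroup α, (∃ s, (g • x ∈ inside W s ∧ g • y ∈ outside W s) ∨
      (g • y ∈ inside W s ∧ g • x ∈ outside W s)) ∨ (g • x ∈ crossing W ∧ g • y ∈ crossing W) := by
  obtain ⟨ξ, rfl⟩ := mk_surjective x
  obtain ⟨η, rfl⟩ := mk_surjective y
  by_cases hξ : ∀ ζ, mk W ζ = mk W ξ → ζ = ξ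
  · obtain ⟨g, s, h⟩ := exists_separating_edge_of_fiber hξ hxy.symm
    exact ⟨g, Or.inl ⟨s, Or.inr h⟩⟩
  by_cases hη : ∀ ζ, mk W ζ = mk W η → ζ = η
  · obtain ⟨g, s, h⟩ := exists_separating_edge_of_fiber hη hxy
    exact ⟨g, Or.inl ⟨s, Or.inl h⟩⟩
  obtain ⟨ξ', hξ', hξne⟩ := exists_lineRel_of_fiber hξ
  obtain ⟨η', hη', hηne⟩ := exists_lineRel_of_fiber hη
  obtain ⟨k, hk⟩ := exists_smul_head_ne hξne
  have hex : ∃ n, (k • η).1 n ≠ (k • η').1 n := by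
    by_contra hcon
    push Not at hcon
    exact hηne (smul_left_cancel k (Subtype.ext (funext hcon)))
  obtain ⟨g, hg⟩ := exists_edge_or_vertex (Nat.find hex) hk
    (fun j hj => not_not.1 (Nat.find_min hex hj)) (Nat.find_spec hex)
  simp only [← mul_smul] at hg
  refine ⟨g * k, ?_⟩
  simp only [smul_mk]
  rcases hg with ⟨s, h1, h2, h3, h4⟩ | ⟨h1, h2⟩
  · exact Or.inl ⟨s, Or.inr ⟨mem_inside_of_lineRel (hη'.smul _) h1 h2,
      mem_outside_of_lineRel (hξ'.smul _) h3 h4⟩⟩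
  · exact Or.inr ⟨mk_mem_crossing (hξ'.smul _) h1, mk_mem_crossing (hη'.smul _) h2⟩

/-- There are finitely many orbits of lines. -/
theorem finite_orbits_lines (W : Finset (FreeGroup α)) :
    (MulAction.orbit (FreeGroup α) ''
      {x : DecompositionSpace W | ∃ ξ η, LineEnds W ξ η ∧ x = mk W ξ}).Finite := by
  refine (W.finite_toSet.biUnion (t := fun w => MulAction.orbit (FreeGroup α) ''
    {x : DecompositionSpace W | ∃ g ξ, IsAxisEnd g w ξ ∧ x = mk W ξ}) fun w _ =>
    Set.Subsingleton.finite ?_).subset ?_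
  · rintro _ ⟨_, ⟨g, ξ, h, rfl⟩, rfl⟩ _ ⟨_, ⟨g', ξ', h', rfl⟩, rfl⟩
    -- For a fixed `w`, translation by `g' * g⁻¹` carries `g w^∞` to `g' w^∞`.
    have h1 := h.smul (g' * g⁻¹)
    rw [inv_mul_cancel_right] at h1
    rw [VertexLimit.unique h' h1, ← smul_mk, MulAction.orbit_smul]
  · rintro _ ⟨_, ⟨ξ, η, ⟨w, hw, g, h1, h2⟩, rfl⟩, rfl⟩
    exact Set.mem_biUnion hw ⟨_, ⟨g, ξ, h1, rfl⟩, rfl⟩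

end DecompositionSpace

/-! ### Counting orbits. -/

theorem finite_orbits_of_exists_smul_mem {G Y : Type*} [Group G] [MulAction G Y] {S F : Set Y}
    (hF : F.Finite) (h : ∀ y ∈ S, ∃ g : G, g • y ∈ F) : (MulAction.orbit G '' S).Finite := by
  refine (hF.image (MulAction.orbit G)).subset ?_
  rintro _ ⟨y, hy, rfl⟩
  obtain ⟨g, hg⟩ := h y hy
  exact ⟨g • y, hg, MulAction.orbit_smul g y⟩

open DecompositionSpace in
theorem mainTheorem6 {α : Type*} [DecidableEq α] [Finite α] [Nontrivial α]
    (W : Finset (FreeGroup α)) (hW : ∀ w ∈ W, w ≠ 1)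
    (hconn : ConnectedSpace (DecompositionSpace W)) :
    (MulAction.orbit (FreeGroup α) '' {x : DecompositionSpace W | IsCutPoint x}).Finite ∧
      (MulAction.orbit (FreeGroup α) ''
        {S : Set (DecompositionSpace W) | IsUncrossedCutPair S}).Finite := by
  constructor
  · refine (finite_orbits_lines W).subset (Set.image_mono ?_)
    intro x hx
    obtain ⟨ξ, rfl⟩ := mk_surjective x
    obtain ⟨η, h | h, -⟩ := exists_lineRel_of_fiber fun h => not_isCutPoint_of_fiber h hx
    · exact ⟨ξ, η, h, rfl⟩
    · exact ⟨η, ξ, h, mk_eq_of_lineRel (Or.inr h)⟩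
  -- The finite set of representatives: uncrossed pairs across an edge at the identity, and pairs of
  -- lines through the identity.
  · refine finite_orbits_of_exists_smul_mem
      ((Set.finite_iUnion fun s : α × Bool =>
        finite_uncrossed_across_wall (isWall W s) (finite_wall W s)).union
        ((finite_crossing W).image2 (fun x y => ({x, y} : Set (DecompositionSpace W)))
          (finite_crossing W))) ?_
    intro S hS
    obtain ⟨-, x, y, hxy, hSxy, -, -⟩ := hS.1
    obtain ⟨g, ⟨s, h⟩ | h⟩ := exists_separating_edge_or_vertex hxy
    · have hg := isUncrossedCutPair_smul g hS
      have hgS : g • S = {g • x, g • y} := by rw [hSxy]; exact Set.image_pair _ _ _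
      refine ⟨g, Or.inl (Set.mem_iUnion.2 ⟨s, hg, ?_⟩)⟩
      rcases h with ⟨h1, h2⟩ | ⟨h1, h2⟩
      · exact ⟨_, h1, _, h2, hgS⟩
      · exact ⟨_, h1, _, h2, hgS.trans (Set.pair_comm _ _)⟩
    · refine ⟨g, Or.inr ⟨_, h.1, _, h.2, ?_⟩⟩
      rw [hSxy]
      exact (Set.image_pair _ _ _).symm
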